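/- Fix a field $k$. All categories are small and $k$-linear, and all functors are $k$-linear. A DG category is a category enriched in complexes of $k$-vector spaces; $H^0(\mathcal A)$ has the same objects as $\mathcal A$ and morphisms $H^0(\mathrm{Hom}_{\mathcal A}(X,Y))$. A DG functor is a quasi-equivalence if it is a quasi-isomorphism on all morphism complexes and induces an equivalence on $H^0$; a quasi-functor is a morphism in the localization of the category of small DG categories at the quasi-equivalences, and it induces a functor on $H^0$, well defined up to isomorphism. A DG category $\mathcal A$ is pre-triangulated if, in its pre-triangulated hull (one-sided twisted complexes), every shift $A[n]$ of an object $A$ of $\mathcal A$ and every cone of a closed degree $0$ morphism of $\mathcal A$ is homotopy equivalent to an object of $\mathcal A$; then $H^0(\mathcal A)$ is triangulated. A DG enhancement of a triangulated category $\mathcal T$ is a pair $(\mathcal B,e)$ with $\mathcal B$ a pre-triangulated DG category and $e:H^0(\mathcal B)\to\mathcal T$ an equivalence of triangulated categories. We say that $\mathcal T$ has a strongly unique DG enhancement if for any two DG enhancements $(\mathcal B,e)$, $(\mathcal B',e')$ of $\mathcal T$ there is a quasi-functor $\mathcal F:\mathcal B\to\mathcal B'$ such that $H^0(\mathcal F)$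 is an equivalence of triangulated categories and $e\cong e'\circ H^0(\mathcal F)$. Two DG algebras are quasi-isomorphic if they are connected by a zigzag of quasi-isomorphisms of DG algebras, and a DG algebra is formal if it is quasi-isomorphic to its cohomology algebra. For an object $T$ of $\mathcal T$, we write $\mathrm{RHom}^\bullet(T,T)$ for any DG algebra quasi-isomorphic to $\mathrm{Hom}_{\mathcal B}(B,B)$, where $(\mathcal B,e)$ is some DG enhancement of $\mathcal T$ and $B$ is an object of $\mathcal B$ with $e(B)\cong T$. **Statement.** Let $\Phi:\mathcal T_1\to\mathcal T_2$ be an equivalence of triangulated categories, and assume that $\mathcal T_2$ has a strongly unique DG enhancement. Then $\mathcal T_1$ has a strongly unique DG enhancement, and for every object $T$ of $\mathcal T_1$: 1. if $\mathcal T_2$ admits a DG enhancement, then DG algebras $\mathrm{RHom}^\bullet(T,T)$ and $\mathrm{RHom}^\bullet(\Phi(T),\Phi(T))$ exist; 2. for all choices of the enhancements and lifts involved, the DG algebras $\mathrm{RHom}^\bullet(T,T)$ and $\mathrm{RHom}^\bullet(\Phi(T),\Phi(T))$ are quasi-isomorphic; in particular, $\mathrm{RHom}^\bullet(T,T)$ is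 formal if and only if $\mathrm{RHom}^\bullet(\Phi(T),\Phi(T))$ is formal. -/

import Mathlib

open CategoryTheory

universe u

/-- A DG module over the field `k`: a cochain complex of `k`-vector spaces. As for Mathlib's
complexes there is a map `d i j` for all `i j`, which vanishes unless `j = i + 1`. -/
structure DGModule (k : Type u) [Field k] : Type (u + 1) where
  X : ℤ → Type u
  [addCommGroup : ∀ n, AddCommGroup (X n)]
  [module : ∀ n, Module k (X n)]
  d : ∀ i j : ℤ, X i →ₗ[k] X j
  shape : ∀ i j : ℤ, i + 1 ≠ j → d i j = 0
  d_d : ∀ (i j l : ℤ) (x : X i), d j l (d i j x) = 0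

namespace DGModule

attribute [instance] DGModule.addCommGroup DGModule.module

variable {k : Type u} [Field k]

/-- Transport of elements along an equality of degrees. -/
def cast (M : DGModule k) {m n : ℤ} (h : m = n) : M.X m →ₗ[k] M.X n :=
  h ▸ LinearMap.id

@[simp] lemma cast_rfl (M : DGModule k) {m : ℤ} (h : m = m) (x : M.X m) : M.cast h x = x := rfl

@[simp] lemma cast_cast (M : DGModule k) {m n p : ℤ} (h : m = n) (h' : n = p) (x : M.X m) :
    M.cast h' (M.cast h x) = M.cast (h.trans h') x := by
  subst h h'; rfl

/-- The cocycles (closed elements) of degree `n`. -/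
def cocycles (M : DGModule k) (n : ℤ) : Submodule k (M.X n) := LinearMap.ker (M.d n (n + 1))

/-- The coboundaries of degree `n`. -/
def coboundaries (M : DGModule k) (n : ℤ) : Submodule k (M.X n) :=
  LinearMap.range (M.d (n - 1) n)

/-- The cohomology in degree `n`: cocycles modulo coboundaries. -/
abbrev H (M : DGModule k) (n : ℤ) : Type u :=
  M.cocycles n ⧸ (M.coboundaries n).submoduleOf (M.cocycles n)

/-- The cohomology class of a closed element. -/
abbrev mkH (M : DGModule k) (n : ℤ) : M.cocycles n →ₗ[k] M.H n :=
  Submodule.mkQ _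

lemma mem_cocycles (M : DGModule k) {n : ℤ} (x : M.X n) :
    x ∈ M.cocycles n ↔ M.d n (n + 1) x = 0 := LinearMap.mem_ker

lemma mem_cocycles_iff (M : DGModule k) {n : ℤ} (x : M.X n) :
    x ∈ M.cocycles n ↔ ∀ m, M.d n m x = 0 := by
  rw [mem_cocycles]
  refine ⟨fun h m => ?_, fun h => h _⟩
  by_cases hm : n + 1 = m
  · subst hm; exact h
  · rw [M.shape n m hm]; rfl

lemma mkH_eq_zero (M : DGModule k) {n : ℤ} (x : M.cocycles n) :
    M.mkH n x = 0 ↔ ∃ y : M.X (n - 1), M.d (n - 1) n y = x := by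
  rw [mkH, Submodule.mkQ_apply, Submodule.Quotient.mk_eq_zero]
  exact Iff.rfl

lemma mkH_eq_zero_of (M : DGModule k) {n : ℤ} (x : M.cocycles n) {m : ℤ} (y : M.X m)
    (h : M.d m n y = x) : M.mkH n x = 0 := by
  rw [mkH_eq_zero]
  by_cases hm : m + 1 = n
  · obtain rfl : m = n - 1 := by omega
    exact ⟨y, h⟩
  · exact ⟨0, by rw [← h, M.shape m n hm]; simp⟩

/-- Morphisms of DG modules: degree-preserving linear maps commuting with differentials. -/
@[ext]
structure Hom (M N : DGModule k) where
  f : ∀ n : ℤ, M.X n →ₗ[k] N.X n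
  comm : ∀ (i j : ℤ) (x : M.X i), f j (M.d i j x) = N.d i j (f i x)

/-- The map induced on cocycles. -/
def Hom.mapZ {M N : DGModule k} (φ : Hom M N) (n : ℤ) : M.cocycles n →ₗ[k] N.cocycles n :=
  (φ.f n).restrict fun x hx => by
    rw [mem_cocycles] at hx ⊢
    rw [← φ.comm, hx, map_zero]

/-- The map induced on cohomology. -/
def Hom.mapH {M N : DGModule k} (φ : Hom M N) (n : ℤ) : M.H n →ₗ[k] N.H n :=
  Submodule.mapQ _ _ (φ.mapZ n) fun x hx => by
    obtain ⟨y, hy⟩ := hx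
    exact ⟨φ.f _ y, by rw [← φ.comm, hy]; rfl⟩

@[simp] lemma Hom.mapH_mk {M N : DGModule k} (φ : Hom M N) (n : ℤ) (x : M.cocycles n) :
    φ.mapH n (M.mkH n x) = N.mkH n (φ.mapZ n x) := rfl

/-- Quasi-isomorphisms of DG modules. -/
def Hom.IsQuasiIso {M N : DGModule k} (φ : Hom M N) : Prop :=
  ∀ n, Function.Bijective (φ.mapH n)

lemma map_units {V W : Type*} [AddCommGroup V] [AddCommGroup W] [Module k V] [Module k W]
    (f : V →ₗ[k] W) (s : ℤˣ) (x : V) : f (s • x) = s • f x := by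
  rw [Units.smul_def, Units.smul_def, map_zsmul]

lemma map_units_left {U V W : Type*} [AddCommGroup U] [AddCommGroup V] [AddCommGroup W]
    [Module k U] [Module k V] [Module k W] (f : U →ₗ[k] V →ₗ[k] W) (s : ℤˣ) (x : U) (y : V) :
    f (s • x) y = s • f x y := by
  rw [Units.smul_def, Units.smul_def, map_zsmul, LinearMap.smul_apply]

lemma units_apply {V W : Type*} [AddCommGroup V] [AddCommGroup W] [Module k V] [Module k W]
    (f : V →ₗ[k] W) (s : ℤˣ) (x : V) : (s • f) x = s • f x := rfl

end DGModule

/-- A small DG category over `k`. The composition `comp _ g f` of `f : X → Y` and `g : Y → Z` is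
the usual `g ∘ f`; it is bilinear and satisfies the graded Leibniz rule, that is, it is a morphism
of DG modules from the tensor product `Hom Y Z ⊗ Hom X Y` to `Hom X Z`. -/
structure DGCat (k : Type u) [Field k] : Type (u + 1) where
  Obj : Type u
  Hom : Obj → Obj → DGModule k
  comp : ∀ {X Y Z : Obj} {p q n : ℤ}, p + q = n →
    ((Hom Y Z).X p →ₗ[k] (Hom X Y).X q →ₗ[k] (Hom X Z).X n)
  one : ∀ X : Obj, (Hom X X).X 0
  leibniz : ∀ {X Y Z : Obj} {p q n p' q' m : ℤ} (h : p + q = n) (hp : p + 1 = p')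
    (hq : q + 1 = q') (hm : n + 1 = m) (g : (Hom Y Z).X p) (f : (Hom X Y).X q),
    (Hom X Z).d n m (comp h g f) =
      comp (show p' + q = m by omega) ((Hom Y Z).d p p' g) f +
        p.negOnePow • comp (show p + q' = m by omega) g ((Hom X Y).d q q' f)
  assoc : ∀ {W X Y Z : Obj} {p q r a b n : ℤ} (ha : p + q = a) (hb : q + r = b) (h : a + r = n)
    (h' : p + b = n) (g : (Hom Y Z).X p) (f : (Hom X Y).X q) (e : (Hom W X).X r),
    comp h (comp ha g f) e = comp h' g (comp hb f e)
  one_comp : ∀ {X Y : Obj} {n : ℤ} (f : (Hom X Y).X n), comp (zero_add n) (one Y) f = f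
  comp_one : ∀ {X Y : Obj} {n : ℤ} (f : (Hom X Y).X n), comp (add_zero n) f (one X) = f
  d_one : ∀ X : Obj, (Hom X X).d 0 1 (one X) = 0

/-- A DG functor. -/
@[ext]
structure DGFunctor {k : Type u} [Field k] (A B : DGCat k) where
  obj : A.Obj → B.Obj
  map : ∀ X Y : A.Obj, DGModule.Hom (A.Hom X Y) (B.Hom (obj X) (obj Y))
  map_comp : ∀ {X Y Z : A.Obj} {p q n : ℤ} (h : p + q = n) (g : (A.Hom Y Z).X p)
    (f : (A.Hom X Y).X q),
    (map X Z).f n (A.comp h g f) = B.comp h ((map Y Z).f p g) ((map X Y).f q f)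
  map_one : ∀ X : A.Obj, (map X X).f 0 (A.one X) = B.one (obj X)

/-- The category `dgCat` of small DG categories and DG functors. -/
instance {k : Type u} [Field k] : Category (DGCat k) where
  Hom A B := DGFunctor A B
  id A :=
    { obj := id
      map := fun _ _ => ⟨fun _ => LinearMap.id, fun _ _ _ => rfl⟩
      map_comp := fun _ _ _ => rfl
      map_one := fun _ => rfl }
  comp F G :=
    { obj := fun X => G.obj (F.obj X)
      map := fun X Y => ⟨fun n => (G.map _ _).f n ∘ₗ (F.map X Y).f n, fun i j x => by
        simp only [LinearMap.comp_apply]; rw [(F.map X Y).comm, (G.map _ _).comm]⟩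
      map_comp := fun h g f => by
        simp only [LinearMap.comp_apply]; rw [F.map_comp, G.map_comp]
      map_one := fun X => by
        simp only [LinearMap.comp_apply]; rw [F.map_one, G.map_one] }

namespace DGCat

variable {k : Type u} [Field k]

section Cohomology

variable (A : DGCat k)

/-- The composition of closed elements. -/
def compZ {X Y Z : A.Obj} {p q n : ℤ} (h : p + q = n) :
    (A.Hom Y Z).cocycles p →ₗ[k] (A.Hom X Y).cocycles q →ₗ[k] (A.Hom X Z).cocycles n :=
  LinearMap.mk₂ k
    (fun g f => ⟨A.comp h g.1 f.1, by
      have hg := ((A.Hom Y Z).mem_cocycles _).1 g.2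
      have hf := ((A.Hom X Y).mem_cocycles _).1 f.2
      rw [DGModule.mem_cocycles, A.leibniz h rfl rfl rfl, hg, hf]
      simp⟩)
    (fun _ _ _ => Subtype.ext (by simp)) (fun _ _ _ => Subtype.ext (by simp))
    (fun _ _ _ => Subtype.ext (by simp)) (fun _ _ _ => Subtype.ext (by simp))

lemma compZ_coe {X Y Z : A.Obj} {p q n : ℤ} (h : p + q = n) (g : (A.Hom Y Z).cocycles p)
    (f : (A.Hom X Y).cocycles q) : (A.compZ h g f : (A.Hom X Z).X n) = A.comp h g.1 f.1 := rfl

/-- The composition on cohomology. -/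
def compH {X Y Z : A.Obj} {p q n : ℤ} (h : p + q = n) :
    (A.Hom Y Z).H p →ₗ[k] (A.Hom X Y).H q →ₗ[k] (A.Hom X Z).H n :=
  Submodule.liftQ _
    (LinearMap.mk₂ k (fun g => Submodule.liftQ _ ((A.Hom X Z).mkH n ∘ₗ A.compZ h g) (by
        rintro f ⟨y, hy⟩
        refine (A.Hom X Z).mkH_eq_zero_of _ (m := p + (q - 1))
          (p.negOnePow • A.comp rfl g.1 y) ?_
        have hg := ((A.Hom Y Z).mem_cocycles _).1 g.2
        rw [DGModule.map_units, A.leibniz (p' := p + 1) (q' := q) rfl rfl (by omega) (by omega),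
          hg, hy]
        simp [smul_smul, compZ_coe]))
      (fun g g' f => by
        induction f using Submodule.Quotient.induction_on with | _ f => simp)
      (fun c g f => by
        induction f using Submodule.Quotient.induction_on with | _ f => simp)
      (fun g f f' => by simp) (fun c g f => by simp))
    (by
      rintro g ⟨y, hy⟩
      refine LinearMap.ext fun f => ?_
      induction f using Submodule.Quotient.induction_on with | _ f => ?_
      refine (A.Hom X Z).mkH_eq_zero_of _ (m := (p - 1) + q) (A.comp rfl y f.1) ?_
      have hf := ((A.Hom X Y).mem_cocycles _).1 f.2
      rw [A.leibniz (p' := p) (q' := q + 1) rfl (by omega) rfl (by omega), hf, hy]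
      simp [compZ_coe])

lemma compH_mk {X Y Z : A.Obj} {p q n : ℤ} (h : p + q = n) (g : (A.Hom Y Z).cocycles p)
    (f : (A.Hom X Y).cocycles q) :
    A.compH h ((A.Hom Y Z).mkH p g) ((A.Hom X Y).mkH q f) = (A.Hom X Z).mkH n (A.compZ h g f) :=
  rfl

/-- The identity as a closed element. -/
def oneZ (X : A.Obj) : (A.Hom X X).cocycles 0 := ⟨A.one X, A.d_one X⟩

/-- The class of the identity. -/
def oneH (X : A.Obj) : (A.Hom X X).H 0 := (A.Hom X X).mkH 0 (A.oneZ X)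

lemma assocH {W X Y Z : A.Obj} {p q r a b n : ℤ} (ha : p + q = a) (hb : q + r = b)
    (h : a + r = n) (h' : p + b = n) (g : (A.Hom Y Z).H p) (f : (A.Hom X Y).H q)
    (e : (A.Hom W X).H r) :
    A.compH h (A.compH ha g f) e = A.compH h' g (A.compH hb f e) := by
  obtain ⟨g, rfl⟩ := Submodule.mkQ_surjective _ g
  obtain ⟨f, rfl⟩ := Submodule.mkQ_surjective _ f
  obtain ⟨e, rfl⟩ := Submodule.mkQ_surjective _ e
  simp only [compH_mk]
  exact congrArg _ (Subtype.ext (A.assoc ha hb h h' _ _ _))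

lemma oneH_comp {X Y : A.Obj} {n : ℤ} (f : (A.Hom X Y).H n) :
    A.compH (zero_add n) (A.oneH Y) f = f := by
  obtain ⟨f, rfl⟩ := Submodule.mkQ_surjective _ f
  exact congrArg _ (Subtype.ext (A.one_comp _))

lemma compH_one {X Y : A.Obj} {n : ℤ} (f : (A.Hom X Y).H n) :
    A.compH (add_zero n) f (A.oneH X) = f := by
  obtain ⟨f, rfl⟩ := Submodule.mkQ_surjective _ f
  exact congrArg _ (Subtype.ext (A.comp_one _))

/-- The graded cohomology category, viewed as a DG category with zero differential. -/
def coh : DGCat k where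
  Obj := A.Obj
  Hom X Y :=
    { X := fun n => (A.Hom X Y).H n
      d := fun _ _ => 0
      shape := fun _ _ _ => rfl
      d_d := fun _ _ _ _ => rfl }
  comp h := A.compH h
  one := A.oneH
  leibniz := by intros; simp
  assoc := A.assocH
  one_comp := A.oneH_comp
  comp_one := A.compH_one
  d_one _ := rfl

end Cohomology

/-- The homotopy category `H⁰(A)`: same objects, morphisms are `H⁰` of the DG modules of
morphisms. -/
def H0 (A : DGCat k) : Type u := A.Obj

section H0

variable (A : DGCat k)

instance : Category.{u} A.H0 where
  Hom X Y := (A.Hom X Y).H 0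
  id X := A.oneH X
  comp f g := A.compH (add_zero 0) g f
  id_comp f := A.compH_one f
  comp_id f := A.oneH_comp f
  assoc _ _ _ := (A.assocH _ _ _ _ _ _ _).symm

instance : Preadditive A.H0 where
  homGroup X Y := inferInstanceAs (AddCommGroup ((A.Hom X Y).H 0))
  add_comp _ _ _ f f' g := (A.compH (add_zero 0) g).map_add f f'
  comp_add _ _ _ f g g' := LinearMap.map_add₂ (A.compH (add_zero 0)) g g' f

instance : Linear k A.H0 where
  homModule X Y := inferInstanceAs (Module k ((A.Hom X Y).H 0))
  smul_comp _ _ _ r f g := (A.compH (add_zero 0) g).map_smul r f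
  comp_smul _ _ _ f r g := LinearMap.map_smul₂ (A.compH (add_zero 0)) r g f

end H0

lemma _root_.DGFunctor.mapH_compH {A B : DGCat k} (F : DGFunctor A B) {X Y Z : A.Obj}
    {p q n : ℤ} (h : p + q = n) (g : (A.Hom Y Z).H p) (f : (A.Hom X Y).H q) :
    (F.map X Z).mapH n (A.compH h g f) = B.compH h ((F.map Y Z).mapH p g) ((F.map X Y).mapH q f) := by
  obtain ⟨g, rfl⟩ := Submodule.mkQ_surjective _ g
  obtain ⟨f, rfl⟩ := Submodule.mkQ_surjective _ f
  exact congrArg _ (Subtype.ext (F.map_comp h _ _))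

/-- The functor `H⁰(F)` induced by a DG functor `F`. -/
def _root_.DGFunctor.H0map {A B : DGCat k} (F : DGFunctor A B) : A.H0 ⥤ B.H0 where
  obj X := F.obj X
  map {X Y} f := (F.map X Y).mapH 0 f
  map_id X := congrArg ((B.Hom _ _).mkH 0) (Subtype.ext (F.map_one X))
  map_comp f g := F.mapH_compH _ g f

/-- Quasi-equivalences: DG functors that are quasi-isomorphisms on morphisms and induce an
equivalence of homotopy categories. -/
def quasiEquivalences (k : Type u) [Field k] : MorphismProperty (DGCat k) :=
  fun _ _ F => (∀ X Y, (DGFunctor.map F X Y).IsQuasiIso) ∧ (DGFunctor.H0map F).IsEquivalence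

/-- The localization `Hqe` of `dgCat` with respect to quasi-equivalences. -/
abbrev Hqe (k : Type u) [Field k] := (quasiEquivalences k).Localization

/-- A quasi-functor is a morphism in `Hqe`. -/
abbrev QuasiFunctor (A B : DGCat k) :=
  (quasiEquivalences k).Q.obj A ⟶ (quasiEquivalences k).Q.obj B

/-- Isomorphism of functors, as a relation on the morphisms of `Cat`. -/
def isoRel : HomRel Cat.{u, u} := fun _ _ F G => Nonempty (F.toFunctor ≅ G.toFunctor)

instance : Congruence isoRel.{u} where
  equivalence :=
    { refl := fun _ => ⟨Iso.refl _⟩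
      symm := fun ⟨e⟩ => ⟨e.symm⟩
      trans := fun ⟨e⟩ ⟨e'⟩ => ⟨e ≪≫ e'⟩ }
  comp_left F _ _ := fun ⟨e⟩ => ⟨Functor.isoWhiskerLeft F.toFunctor e⟩
  comp_right G := fun ⟨e⟩ => ⟨Functor.isoWhiskerRight e G.toFunctor⟩

/-- Small categories with isomorphism classes of functors as morphisms. -/
abbrev CatUpToIso := CategoryTheory.Quotient isoRel.{u}

/-- The isomorphism class of a functor. -/
def isoClass {C D : Type u} [SmallCategory C] [SmallCategory D] (F : C ⥤ D) :
    (Quotient.functor isoRel.{u}).obj (Cat.of C) ⟶ (Quotient.functor isoRel.{u}).obj (Cat.of D) :=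
  (Quotient.functor isoRel.{u}).map F.toCatHom

/-- `H⁰` as a functor from DG categories to categories with isomorphism classes of functors. -/
def H0Functor (k : Type u) [Field k] : DGCat k ⥤ CatUpToIso.{u} where
  obj A := (Quotient.functor isoRel.{u}).obj (Cat.of A.H0)
  map F := isoClass (DGFunctor.H0map F)
  map_id A := (Quotient.functor_map_eq_iff isoRel.{u} _ _).2
    ⟨NatIso.ofComponents (fun _ => Iso.refl _) (fun f => by
      obtain ⟨f, rfl⟩ := Submodule.mkQ_surjective _ f
      exact (Category.comp_id _).trans (Category.id_comp _).symm)⟩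
  map_comp F G := (Quotient.functor_map_eq_iff isoRel.{u} _ _).2
    ⟨NatIso.ofComponents (fun _ => Iso.refl _) (fun f => by
      obtain ⟨f, rfl⟩ := Submodule.mkQ_surjective _ f
      exact (Category.comp_id _).trans (Category.id_comp _).symm)⟩

lemma H0Functor_inverts (k : Type u) [Field k] :
    (quasiEquivalences k).IsInvertedBy (H0Functor k) := by
  intro A B F hF
  have := hF.2
  let e := (DGFunctor.H0map F).asEquivalence
  refine ⟨isoClass e.inverse, ?_, ?_⟩
  · exact (Quotient.functor_map_eq_iff isoRel.{u} _ _).2 ⟨e.unitIso.symm⟩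
  · exact (Quotient.functor_map_eq_iff isoRel.{u} _ _).2 ⟨e.counitIso⟩

/-- The functor induced by `H⁰` on the localization `Hqe`; it sends a quasi-functor `F` to the
isomorphism class of functors `H⁰(F)`. -/
noncomputable def H0Hqe (k : Type u) [Field k] : Hqe k ⥤ CatUpToIso.{u} :=
  Localization.Construction.lift (H0Functor k) (H0Functor_inverts k)

/-- The functor `G` is (a representative of) `H⁰(F)`, for a quasi-functor `F`. -/
def QuasiFunctor.IsH0 {A B : DGCat k} (F : QuasiFunctor A B) (G : A.H0 ⥤ B.H0) : Prop :=
  (H0Hqe k).map F = isoClass G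

section Hull

variable (A : DGCat k)

lemma comp_cast {X Y Z : A.Obj} {p q n p' q' n' : ℤ} (h : p' + q' = n') (hp : p = p')
    (hq : q = q') (h₀ : p + q = n) (hn : n = n') (g : (A.Hom Y Z).X p) (f : (A.Hom X Y).X q) :
    A.comp h ((A.Hom Y Z).cast hp g) ((A.Hom X Y).cast hq f) =
      (A.Hom X Z).cast hn (A.comp h₀ g f) := by
  subst hp hq hn; rfl

/-- The identity morphism, along equalities of objects and of degrees. -/
def eqOne {X Y : A.Obj} (e : X = Y) {n : ℤ} (hn : 0 = n) : (A.Hom X Y).X n :=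
  (A.Hom X Y).cast hn (e ▸ A.one X)

lemma eqOne_comp {X Y Z : A.Obj} (e : Y = Z) {p q n : ℤ} (hp : 0 = p) (h : p + q = n)
    (f : (A.Hom X Y).X q) :
    A.comp h (A.eqOne e hp) f = (A.Hom X Z).cast (by omega) (e ▸ f) := by
  subst e hp
  obtain rfl : q = n := by omega
  exact A.one_comp f

lemma comp_eqOne {X Y Z : A.Obj} (e : X = Y) {p q n : ℤ} (hq : 0 = q) (h : p + q = n)
    (f : (A.Hom Y Z).X p) :
    A.comp h f (A.eqOne e hq) = (A.Hom X Z).cast (by omega) (e.symm ▸ f) := by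
  subst e hq
  obtain rfl : p = n := by omega
  exact A.comp_one f

lemma d_eqOne {X Y : A.Obj} (e : X = Y) {n : ℤ} (hn : 0 = n) (m : ℤ) :
    (A.Hom X Y).d n m (A.eqOne e hn) = 0 := by
  subst e hn
  exact ((A.Hom X X).mem_cocycles_iff _).1 (A.oneZ X).2 m

/-- Objects of the category of formal finite sums of shifts of objects of `A`: the family
`(obj i, sh i)` stands for the direct sum of the `(obj i)[sh i]`. -/
structure SumObj : Type u where
  n : ℕ
  obj : Fin n → A.Obj
  sh : Fin n → ℤ

/-- The matrices of degree `m` from `P` to `Q`. -/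
abbrev matX (P Q : SumObj A) (m : ℤ) : Type u :=
  ∀ (i : Fin P.n) (j : Fin Q.n), (A.Hom (P.obj i) (Q.obj j)).X (m + Q.sh j - P.sh i)

/-- The differential of matrices: the differential of `A` on the entries, twisted by the sign of
the shift of the target. -/
def matD (P Q : SumObj A) (a b : ℤ) : A.matX P Q a →ₗ[k] A.matX P Q b :=
  LinearMap.pi fun i => LinearMap.pi fun j =>
    (((Q.sh j).negOnePow : ℤˣ) : ℤ) • ((A.Hom (P.obj i) (Q.obj j)).d _ _ ∘ₗ
      LinearMap.proj (R := k) j ∘ₗ LinearMap.proj (R := k) i)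

lemma matD_apply (P Q : SumObj A) (a b : ℤ) (f : A.matX P Q a) (i : Fin P.n) (j : Fin Q.n) :
    A.matD P Q a b f i j =
      (Q.sh j).negOnePow • (A.Hom (P.obj i) (Q.obj j)).d _ _ (f i j) := rfl

/-- The DG module of matrices. -/
def matHom (P Q : SumObj A) : DGModule k where
  X := A.matX P Q
  d := A.matD P Q
  shape a b h := by
    refine LinearMap.ext fun f => ?_
    funext i j
    rw [matD_apply, (A.Hom (P.obj i) (Q.obj j)).shape _ _ (by omega)]
    exact smul_zero _
  d_d a b c f := by
    funext i j
    simp [matD_apply, DGModule.d_d]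

/-- Matrix multiplication. -/
def matComp {P Q R : SumObj A} {p q n : ℤ} (h : p + q = n) :
    A.matX Q R p →ₗ[k] A.matX P Q q →ₗ[k] A.matX P R n :=
  LinearMap.mk₂ k
    (fun g f i l => ∑ j, A.comp (show p + R.sh l - Q.sh j + (q + Q.sh j - P.sh i) =
      n + R.sh l - P.sh i by omega) (g j l) (f i j))
    (fun _ _ _ => by ext i l; simp [Finset.sum_add_distrib])
    (fun _ _ _ => by ext i l; simp [Finset.smul_sum])
    (fun _ _ _ => by ext i l; simp [Finset.sum_add_distrib])
    (fun _ _ _ => by ext i l; simp [Finset.smul_sum])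

lemma matComp_apply {P Q R : SumObj A} {p q n : ℤ} (h : p + q = n) (g : A.matX Q R p)
    (f : A.matX P Q q) (i : Fin P.n) (l : Fin R.n) :
    A.matComp h g f i l = ∑ j, A.comp (show p + R.sh l - Q.sh j + (q + Q.sh j - P.sh i) =
      n + R.sh l - P.sh i by omega) (g j l) (f i j) := rfl

/-- The identity matrix. -/
def matOne (P : SumObj A) : A.matX P P 0 := fun i j =>
  if e : i = j then A.eqOne (congrArg P.obj e) (by subst e; omega) else 0

lemma matOne_self (P : SumObj A) (i : Fin P.n) :
    A.matOne P i i = A.eqOne rfl (by omega) := dif_pos rfl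

lemma matOne_ne (P : SumObj A) {i j : Fin P.n} (h : i ≠ j) : A.matOne P i j = 0 := dif_neg h

lemma mat_leibniz {P Q R : SumObj A} {p q n p' q' m : ℤ} (h : p + q = n) (hp : p + 1 = p')
    (hq : q + 1 = q') (hm : n + 1 = m) (g : A.matX Q R p) (f : A.matX P Q q) :
    A.matD P R n m (A.matComp h g f) =
      A.matComp (show p' + q = m by omega) (A.matD Q R p p' g) f +
        p.negOnePow • A.matComp (show p + q' = m by omega) g (A.matD P Q q q' f) := by
  funext i l
  simp only [matD_apply, matComp_apply, Pi.add_apply, Pi.smul_apply, map_sum, Finset.smul_sum]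
  rw [← Finset.sum_add_distrib]
  refine Finset.sum_congr rfl fun j _ => ?_
  rw [A.leibniz (p' := p' + R.sh l - Q.sh j) (q' := q' + Q.sh j - P.sh i) (by omega) (by omega)
    (by omega) (by omega)]
  simp only [DGModule.map_units, smul_add, smul_smul]
  congr 2
  rw [Int.negOnePow_sub, Int.negOnePow_add]
  rcases Int.units_eq_one_or (R.sh l).negOnePow with h | h <;> simp [h]

lemma mat_assoc {P Q R S : SumObj A} {p q r a b n : ℤ} (ha : p + q = a) (hb : q + r = b)
    (h : a + r = n) (h' : p + b = n) (g : A.matX R S p) (f : A.matX Q R q) (e : A.matX P Q r) :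
    A.matComp h (A.matComp ha g f) e = A.matComp h' g (A.matComp hb f e) := by
  funext i l
  simp only [matComp_apply, map_sum, LinearMap.sum_apply]
  rw [Finset.sum_comm]
  refine Finset.sum_congr rfl fun j _ => Finset.sum_congr rfl fun j' _ => ?_
  exact A.assoc _ _ _ _ _ _ _

lemma mat_one_comp {P Q : SumObj A} {n : ℤ} (f : A.matX P Q n) :
    A.matComp (zero_add n) (A.matOne Q) f = f := by
  funext i l
  rw [matComp_apply, Finset.sum_eq_single l]
  · rw [matOne_self, eqOne_comp, DGModule.cast_rfl]
  · intro j _ hj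
    rw [matOne_ne A Q hj, map_zero, LinearMap.zero_apply]
  · simp

lemma mat_comp_one {P Q : SumObj A} {n : ℤ} (f : A.matX P Q n) :
    A.matComp (add_zero n) f (A.matOne P) = f := by
  funext i l
  rw [matComp_apply, Finset.sum_eq_single i]
  · rw [matOne_self, comp_eqOne, DGModule.cast_rfl]
  · intro j _ hj
    rw [matOne_ne A P hj.symm, map_zero]
  · simp

lemma mat_d_one (P : SumObj A) : A.matD P P 0 1 (A.matOne P) = 0 := by
  funext i l
  rw [matD_apply]
  by_cases e : i = l
  · subst e
    rw [matOne_self, d_eqOne, smul_zero]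
    rfl
  · rw [matOne_ne A P e, map_zero, smul_zero]
    rfl

/-- The DG category of formal finite sums of shifts of objects of `A`. -/
def sums : DGCat k where
  Obj := SumObj A
  Hom := A.matHom
  comp h := A.matComp h
  one := A.matOne
  leibniz h hp hq hm g f := A.mat_leibniz h hp hq hm g f
  assoc ha hb h h' g f e := A.mat_assoc ha hb h h' g f e
  one_comp f := A.mat_one_comp f
  comp_one f := A.mat_comp_one f
  d_one P := A.mat_d_one P

/-- Solutions of the Maurer-Cartan equation `dq + q² = 0` in degree one endomorphisms. -/
structure TwObj : Type u where
  obj : A.Obj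
  q : (A.Hom obj obj).X 1
  mc : (A.Hom obj obj).d 1 2 q + A.comp (show (1 : ℤ) + 1 = 2 by norm_num) q q = 0

/-- The differential of morphisms between twisted objects: `df + q ∘ f - (-1)^|f| f ∘ q`. -/
def twD (P Q : TwObj A) (i j : ℤ) :
    (A.Hom P.obj Q.obj).X i →ₗ[k] (A.Hom P.obj Q.obj).X j :=
  (A.Hom P.obj Q.obj).d i j + if h : i + 1 = j then
    A.comp (show 1 + i = j by omega) Q.q - ((i.negOnePow : ℤˣ) : ℤ) • (A.comp h).flip P.q else 0

lemma twD_apply (P Q : TwObj A) {i j : ℤ} (h : i + 1 = j) (f : (A.Hom P.obj Q.obj).X i) :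
    A.twD P Q i j f = (A.Hom P.obj Q.obj).d i j f +
      (A.comp (show 1 + i = j by omega) Q.q f - i.negOnePow • A.comp h f P.q) := by
  simp only [twD, dif_pos h]
  rfl

lemma twD_shape (P Q : TwObj A) (i j : ℤ) (h : i + 1 ≠ j) : A.twD P Q i j = 0 := by
  rw [twD, (A.Hom P.obj Q.obj).shape i j h, dif_neg h, add_zero]

lemma twD_twD (P Q : TwObj A) (i j l : ℤ) (f : (A.Hom P.obj Q.obj).X i) :
    A.twD P Q j l (A.twD P Q i j f) = 0 := by
  by_cases hj : i + 1 = j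
  swap
  · simp [A.twD_shape P Q i j hj]
  by_cases hl : j + 1 = l
  swap
  · simp [A.twD_shape P Q j l hl]
  subst hj hl
  have e₁ := A.leibniz (show 1 + i = i + 1 by omega) (show (1 : ℤ) + 1 = 2 by norm_num)
    (rfl : i + 1 = i + 1) (rfl : i + 1 + 1 = i + 1 + 1) Q.q f
  have e₂ := A.leibniz (show i + 1 = i + 1 by omega) (rfl : i + 1 = i + 1)
    (show (1 : ℤ) + 1 = 2 by norm_num) (rfl : i + 1 + 1 = i + 1 + 1) f P.q
  have e₃ := A.assoc (show (1 : ℤ) + 1 = 2 by norm_num) (show 1 + i = i + 1 by omega)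
    (show 2 + i = i + 1 + 1 by omega) (show 1 + (i + 1) = i + 1 + 1 by omega) Q.q Q.q f
  have e₄ := A.assoc (rfl : i + 1 = i + 1) (show (1 : ℤ) + 1 = 2 by norm_num)
    (rfl : i + 1 + 1 = i + 1 + 1) (show i + 2 = i + 1 + 1 by omega) f P.q P.q
  have e₅ := A.assoc (show 1 + i = i + 1 by omega) (rfl : i + 1 = i + 1)
    (rfl : i + 1 + 1 = i + 1 + 1) (show 1 + (i + 1) = i + 1 + 1 by omega) Q.q f P.q
  rw [eq_neg_of_add_eq_zero_left Q.mc] at e₁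
  rw [eq_neg_of_add_eq_zero_left P.mc] at e₂
  simp only [twD, dite_true, LinearMap.add_apply, LinearMap.sub_apply, LinearMap.smul_apply,
    LinearMap.flip_apply, map_add, map_sub, map_neg, LinearMap.neg_apply, map_zsmul, DGModule.d_d,
    e₁, e₂, e₃, e₄, e₅, Int.negOnePow_one, Int.negOnePow_succ, Units.smul_def, Units.val_neg,
    Units.val_one, neg_smul, one_smul, smul_neg]
  have hs : ∀ x : (A.Hom P.obj Q.obj).X (i + 1 + 1),
      ((i.negOnePow : ℤˣ) : ℤ) • ((i.negOnePow : ℤˣ) : ℤ) • x = x := fun x => by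
    rw [smul_smul, ← Units.val_mul, Int.units_mul_self, Units.val_one, one_smul]
  simp only [smul_add, smul_sub, smul_neg, hs]
  abel

/-- The DG module of morphisms between twisted objects. -/
def twHom (P Q : TwObj A) : DGModule k where
  X := (A.Hom P.obj Q.obj).X
  d := A.twD P Q
  shape := A.twD_shape P Q
  d_d := A.twD_twD P Q

lemma tw_leibniz {P Q R : TwObj A} {p q n p' q' m : ℤ} (h : p + q = n) (hp : p + 1 = p')
    (hq : q + 1 = q') (hm : n + 1 = m) (g : (A.Hom Q.obj R.obj).X p)
    (f : (A.Hom P.obj Q.obj).X q) :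
    A.twD P R n m (A.comp h g f) =
      A.comp (show p' + q = m by omega) (A.twD Q R p p' g) f +
        p.negOnePow • A.comp (show p + q' = m by omega) g (A.twD P Q q q' f) := by
  subst h hp hq hm
  rw [twD_apply A P R rfl, twD_apply A Q R rfl, twD_apply A P Q rfl,
    A.leibniz (p' := p + 1) (q' := q + 1) rfl rfl rfl rfl]
  simp only [map_add, map_sub, LinearMap.add_apply, LinearMap.sub_apply,
    DGModule.units_apply, DGModule.map_units]
  rw [A.assoc (show 1 + p = p + 1 by omega) (rfl : p + q = p + q) (by omega)
    (show 1 + (p + q) = p + q + 1 by omega),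
    A.assoc (q := 1) (a := p + 1) (b := q + 1) rfl (by omega) (by omega) (by omega),
    A.assoc (a := p + q) (b := q + 1) rfl rfl rfl (by omega), Int.negOnePow_add]
  simp only [smul_add, smul_sub, smul_smul]
  abel

/-- The DG category of twisted objects over `A`. -/
def tw : DGCat k where
  Obj := TwObj A
  Hom := A.twHom
  comp h := A.comp h
  one P := A.one P.obj
  leibniz h hp hq hm g f := A.tw_leibniz h hp hq hm g f
  assoc := A.assoc
  one_comp := A.one_comp
  comp_one := A.comp_one
  d_one P := by
    refine (A.twD_apply P P (by norm_num : (0 : ℤ) + 1 = 1) _).trans ?_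
    rw [A.d_one, A.comp_one, A.one_comp]
    simp
    rfl

/-- The DG category with objects `O` and the morphisms of `A` between the images of the
objects under a map `O → A.Obj`. -/
def induced {O : Type u} (F : O → A.Obj) : DGCat k where
  Obj := O
  Hom X Y := A.Hom (F X) (F Y)
  comp h := A.comp h
  one X := A.one (F X)
  leibniz := A.leibniz
  assoc := A.assoc
  one_comp := A.one_comp
  comp_one := A.comp_one
  d_one X := A.d_one (F X)

/-- One-sided twisted complexes: formal finite sums of shifts of objects of `A` with a strictly
triangular solution `q` of the Maurer-Cartan equation. -/
structure HullObj : Type u where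
  sum : SumObj A
  q : A.matX sum sum 1
  mc : A.matD sum sum 1 2 q + A.matComp (show (1 : ℤ) + 1 = 2 by norm_num) q q = 0
  one_sided : ∀ i j : Fin sum.n, j ≤ i → q i j = 0

/-- The pre-triangulated hull of `A`: the DG category of one-sided twisted complexes, a full DG
subcategory of the twisted objects over formal finite sums of shifts of objects of `A`. -/
def hull : DGCat k :=
  A.sums.tw.induced (O := A.HullObj) fun P => ⟨P.sum, P.q, P.mc⟩

lemma hull_d (P Q : A.HullObj) {i j : ℤ} (h : i + 1 = j) (f : A.matX P.sum Q.sum i) :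
    (A.hull.Hom P Q).d i j f = (A.matD P.sum Q.sum i j f +
      (A.matComp (show 1 + i = j by omega) Q.q f - i.negOnePow • A.matComp h f P.q) :
        A.matX P.sum Q.sum j) :=
  A.sums.twD_apply ⟨P.sum, P.q, P.mc⟩ ⟨Q.sum, Q.q, Q.mc⟩ h f

lemma hull_d_of (P Q : A.HullObj) {i j : ℤ} (h : i + 1 = j) (f : A.matX P.sum Q.sum i)
    (h₁ : A.matComp (show 1 + i = j by omega) Q.q f = 0) (h₂ : A.matComp h f P.q = 0) :
    (A.hull.Hom P Q).d i j f = (A.matD P.sum Q.sum i j f : A.matX P.sum Q.sum j) :=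
  (A.hull_d P Q h f).trans (by rw [h₁, h₂, smul_zero, sub_zero, add_zero])

/-- The one-term formal sum `X[n]`. -/
abbrev single₀ (X : A.Obj) (n : ℤ) : SumObj A := ⟨1, fun _ => X, fun _ => n⟩

/-- The object `X[n]` of the hull. -/
def single (X : A.Obj) (n : ℤ) : A.HullObj where
  sum := A.single₀ X n
  q := 0
  mc := by rw [map_zero, map_zero, add_zero]
  one_sided _ _ _ := rfl

lemma single_d (X Y : A.Obj) (a b : ℤ) {i j : ℤ} (h : i + 1 = j)
    (f : A.matX (A.single₀ X a) (A.single₀ Y b) i) :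
    (A.hull.Hom (A.single X a) (A.single Y b)).d i j f =
      (A.matD (A.single₀ X a) (A.single₀ Y b) i j f :
        A.matX (A.single₀ X a) (A.single₀ Y b) j) :=
  A.hull_d_of (A.single X a) (A.single Y b) h f (LinearMap.map_zero₂ _ _) (map_zero (A.matComp h f))

/-- The action of the shift by `n` on morphisms of `A`. -/
def shiftMat (n : ℤ) (X Y : A.Obj) (m : ℤ) :
    (A.Hom X Y).X m →ₗ[k] A.matX (A.single₀ X n) (A.single₀ Y n) m :=
  LinearMap.pi fun _ => LinearMap.pi fun _ =>
    (((n * m).negOnePow : ℤˣ) : ℤ) • (A.Hom X Y).cast (show m = m + n - n by omega)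

lemma shiftMat_apply (n : ℤ) (X Y : A.Obj) (m : ℤ) (f : (A.Hom X Y).X m) (s t : Fin 1) :
    A.shiftMat n X Y m f s t =
      (n * m).negOnePow • (A.Hom X Y).cast (show m = m + n - n by omega) f := rfl

lemma cast_d {X Y : A.Obj} {m n m' n' : ℤ} (hm : m = m') (hn : n = n') (f : (A.Hom X Y).X m) :
    (A.Hom X Y).d m' n' ((A.Hom X Y).cast hm f) = (A.Hom X Y).cast hn ((A.Hom X Y).d m n f) := by
  subst hm hn; rfl

lemma shiftMat_d (n : ℤ) (X Y : A.Obj) {i j : ℤ} (h : i + 1 = j) (f : (A.Hom X Y).X i) :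
    A.shiftMat n X Y j ((A.Hom X Y).d i j f) =
      A.matD (A.single₀ X n) (A.single₀ Y n) i j (A.shiftMat n X Y i f) := by
  funext s t
  rw [matD_apply, shiftMat_apply, shiftMat_apply, DGModule.map_units,
    A.cast_d _ (show j = j + n - n by omega), smul_smul, ← Int.negOnePow_add]
  subst h
  congr 2
  ring

lemma shiftMat_comp (n : ℤ) {X Y Z : A.Obj} {p q m : ℤ} (h : p + q = m) (g : (A.Hom Y Z).X p)
    (f : (A.Hom X Y).X q) :
    A.shiftMat n X Z m (A.comp h g f) =
      A.matComp h (A.shiftMat n Y Z p g) (A.shiftMat n X Y q f) := by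
  funext s t
  rw [matComp_apply, Fin.sum_univ_one]
  simp only [shiftMat_apply, DGModule.map_units, DGModule.units_apply, smul_smul]
  rw [← Int.negOnePow_add, A.comp_cast _ _ _ h (by omega)]
  congr 2
  rw [← h]
  ring

lemma shiftMat_one (n : ℤ) (X : A.Obj) :
    A.shiftMat n X X 0 (A.one X) = A.matOne (A.single₀ X n) := by
  funext s t
  obtain rfl : s = t := Subsingleton.elim _ _
  rw [shiftMat_apply, matOne_self, mul_zero, Int.negOnePow_zero, one_smul]
  rfl

/-- The DG functor `X ↦ X[n]` from `A` to its hull. -/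
def shiftEmb (n : ℤ) : DGFunctor A A.hull where
  obj X := A.single X n
  map X Y :=
    { f := fun m => A.shiftMat n X Y m
      comm := fun i j f => by
        by_cases h : i + 1 = j
        · exact (A.shiftMat_d n X Y h f).trans (A.single_d X Y n n h _).symm
        · rw [DGModule.shape _ _ _ h, DGModule.shape _ _ _ h]
          exact map_zero _ }
  map_comp h g f := A.shiftMat_comp n h g f
  map_one X := A.shiftMat_one n X

/-- The embedding of `A` in its hull. -/
def emb : DGFunctor A A.hull := A.shiftEmb 0

/-- The formal sum `X[1] ⊕ Y`. -/
abbrev cone₀ (X Y : A.Obj) : SumObj A := ⟨2, ![X, Y], ![1, 0]⟩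

/-- The matrix with the only nonzero entry `f : X[1] → Y`. -/
def coneQ {X Y : A.Obj} (f : (A.Hom X Y).X 0) : A.matX (A.cone₀ X Y) (A.cone₀ X Y) 1 := fun i j =>
  match i, j with
  | 0, 1 => f
  | 0, 0 => 0
  | 1, _ => 0

lemma coneQ_zero {X Y : A.Obj} (f : (A.Hom X Y).X 0) (i j : Fin 2) (h : j = 0 ∨ i = 1) :
    A.coneQ f i j = 0 := by
  fin_cases i <;> fin_cases j <;> first | rfl | simp at h

lemma coneQ_one_sided {X Y : A.Obj} (f : (A.Hom X Y).X 0) (i j : Fin 2) (h : j ≤ i) :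
    A.coneQ f i j = 0 :=
  A.coneQ_zero f i j (by omega)

lemma coneQ_d {X Y : A.Obj} (f : (A.Hom X Y).cocycles 0) (i j : Fin 2) (m : ℤ) :
    (A.Hom (![X, Y] i) (![X, Y] j)).d _ m (A.coneQ f.1 i j) = 0 := by
  by_cases h : j = 0 ∨ i = 1
  · rw [coneQ_zero A _ i j h, map_zero]
  · obtain ⟨rfl, rfl⟩ : i = 0 ∧ j = 1 := by omega
    exact ((A.Hom X Y).mem_cocycles_iff _).1 f.2 m

/-- The cone of a closed morphism `f : X → Y` of degree zero: the object `X[1] ⊕ Y` of the hull,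
twisted by `f`. -/
def cone {X Y : A.Obj} (f : (A.Hom X Y).cocycles 0) : A.HullObj where
  sum := A.cone₀ X Y
  q := A.coneQ f.1
  mc := by
    funext i j
    rw [Pi.add_apply, Pi.add_apply, matD_apply, matComp_apply, Fin.sum_univ_two, coneQ_d,
      coneQ_zero A f.1 i 0 (Or.inl rfl), coneQ_zero A f.1 1 j (Or.inr rfl), map_zero, map_zero,
      LinearMap.zero_apply, smul_zero, add_zero, add_zero]
    rfl
  one_sided := A.coneQ_one_sided f.1

/-- The inclusion of `Y` in `X[1] ⊕ Y`. -/
def coneIn₀ (X Y : A.Obj) : A.matX (A.single₀ Y 0) (A.cone₀ X Y) 0 := fun _ j =>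
  match j with
  | 0 => 0
  | 1 => A.one Y

/-- The projection from `X[1] ⊕ Y` to `X[1]`. -/
def coneOut₀ (X Y : A.Obj) : A.matX (A.cone₀ X Y) (A.single₀ X 1) 0 := fun i _ =>
  match i with
  | 0 => A.one X
  | 1 => 0

lemma coneIn₀_zero (X Y : A.Obj) (i : Fin 1) : A.coneIn₀ X Y i 0 = 0 := rfl

lemma coneOut₀_one (X Y : A.Obj) (j : Fin 1) : A.coneOut₀ X Y 1 j = 0 := rfl

lemma coneIn₀_d (X Y : A.Obj) (i : Fin 1) (j : Fin 2) (m : ℤ) :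
    (A.Hom Y (![X, Y] j)).d _ m (A.coneIn₀ X Y i j) = 0 := by
  fin_cases j
  · exact map_zero _
  · exact ((A.Hom Y Y).mem_cocycles_iff _).1 (A.oneZ Y).2 m

lemma coneOut₀_d (X Y : A.Obj) (i : Fin 2) (j : Fin 1) (m : ℤ) :
    (A.Hom (![X, Y] i) X).d _ m (A.coneOut₀ X Y i j) = 0 := by
  fin_cases i
  · exact ((A.Hom X X).mem_cocycles_iff _).1 (A.oneZ X).2 m
  · exact map_zero _

/-- The inclusion of `Y` in the cone of `f : X → Y`, as a closed morphism. -/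
def coneIn {X Y : A.Obj} (f : (A.Hom X Y).cocycles 0) :
    (A.hull.Hom (A.single Y 0) (A.cone f)).cocycles 0 :=
  ⟨A.coneIn₀ X Y, by
    have h₁ : A.matD (A.single₀ Y 0) (A.cone₀ X Y) 0 1 (A.coneIn₀ X Y) = 0 := by
      funext i j
      rw [matD_apply, coneIn₀_d, smul_zero]
      rfl
    have h₂ : A.matComp (show (1 : ℤ) + 0 = 1 by norm_num) (A.coneQ f.1) (A.coneIn₀ X Y) = 0 := by
      funext i j
      rw [matComp_apply, Fin.sum_univ_two, coneIn₀_zero, coneQ_zero A f.1 1 j (Or.inr rfl),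
        map_zero, map_zero, LinearMap.zero_apply, add_zero]
      rfl
    exact (A.hull_d_of (A.single Y 0) (A.cone f) (zero_add 1) (A.coneIn₀ X Y) h₂
      (map_zero (A.matComp (zero_add 1) (A.coneIn₀ X Y)))).trans h₁⟩

/-- The projection from the cone of `f : X → Y` to `X[1]`, as a closed morphism. -/
def coneOut {X Y : A.Obj} (f : (A.Hom X Y).cocycles 0) :
    (A.hull.Hom (A.cone f) (A.single X 1)).cocycles 0 :=
  ⟨A.coneOut₀ X Y, by
    have h₁ : A.matD (A.cone₀ X Y) (A.single₀ X 1) 0 1 (A.coneOut₀ X Y) = 0 := by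
      funext i j
      rw [matD_apply, coneOut₀_d, smul_zero]
      rfl
    have h₃ : A.matComp (zero_add 1) (A.coneOut₀ X Y) (A.coneQ f.1) = 0 := by
      funext i j
      rw [matComp_apply, Fin.sum_univ_two, coneOut₀_one, coneQ_zero A f.1 i 0 (Or.inl rfl),
        map_zero, map_zero, LinearMap.zero_apply, add_zero]
      rfl
    exact (A.hull_d_of (A.cone f) (A.single X 1) (zero_add 1) (A.coneOut₀ X Y)
      (LinearMap.map_zero₂ _ _) h₃).trans h₁⟩

/-- `A` is pre-triangulated: in the hull, all shifts of objects of `A` and all cones of closed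
morphisms of degree zero of `A` are homotopy equivalent (that is, isomorphic in the homotopy
category) to objects of `A`. -/
class IsPretriangulated : Prop where
  exists_shift : ∀ (X : A.Obj) (n : ℤ), ∃ Y : A.Obj,
    Nonempty (A.emb.H0map.obj Y ≅ (A.single X n : A.hull.H0))
  exists_cone : ∀ {X Y : A.Obj} (f : (A.Hom X Y).cocycles 0), ∃ Z : A.Obj,
    Nonempty (A.emb.H0map.obj (Z : A.H0) ≅ (A.cone f : A.hull.H0))

end Hull

section Graded

variable (A : DGCat k)

/-- The graded homotopy category of `A`, seen as an ordinary category: a morphism is a cohomology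
class together with its degree. -/
def Gr : Type u := A.Obj

lemma compH_sigma {X Y Z : A.Obj} {p q n : ℤ} (h : p + q = n) (g : (A.Hom Y Z).H p)
    (f : (A.Hom X Y).H q) :
    (⟨n, A.compH h g f⟩ : Σ n : ℤ, (A.Hom X Z).H n) = ⟨p + q, A.compH rfl g f⟩ := by
  subst h; rfl

instance : Category.{u} A.Gr where
  Hom X Y := Σ n : ℤ, (A.Hom X Y).H n
  id X := ⟨0, A.oneH X⟩
  comp f g := ⟨g.1 + f.1, A.compH rfl g.2 f.2⟩
  id_comp f := (A.compH_sigma (add_zero f.1) f.2 _).symm.trans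
    (congrArg (Sigma.mk f.1) (A.compH_one f.2))
  comp_id f := (A.compH_sigma (zero_add f.1) _ f.2).symm.trans
    (congrArg (Sigma.mk f.1) (A.oneH_comp f.2))
  assoc e f g := (A.compH_sigma (add_assoc g.1 f.1 e.1).symm _ _).symm.trans
    (congrArg (Sigma.mk (g.1 + f.1 + e.1)) (A.assocH rfl rfl rfl _ g.2 f.2 e.2).symm)

/-- A cohomology class of degree `n`, as a morphism of `A.Gr`. -/
def gr {X Y : A.Gr} (n : ℤ) (f : (A.Hom X Y).H n) : X ⟶ Y := ⟨n, f⟩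

lemma gr_compH {X Y Z : A.Gr} {p q n : ℤ} (h : p + q = n) (g : (A.Hom Y Z).H p)
    (f : (A.Hom X Y).H q) : A.gr n (A.compH h g f) = A.gr q f ≫ A.gr p g :=
  A.compH_sigma h g f

lemma gr_injective {X Y : A.Gr} {n : ℤ} {f g : (A.Hom X Y).H n} (h : A.gr n f = A.gr n g) :
    f = g :=
  sigma_mk_injective h

/-- The inclusion of the homotopy category in the graded homotopy category. -/
def toGr : A.H0 ⥤ A.Gr where
  obj X := X
  map f := A.gr 0 f
  map_id _ := rfl
  map_comp f g := A.gr_compH _ g f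

instance : A.toGr.Faithful := ⟨fun h => A.gr_injective h⟩

/-- The entry of a matrix of size one. -/
def entry (X Y : A.Obj) {a b m c : ℤ} (h : m + b - a = c) :
    A.matX (A.single₀ X a) (A.single₀ Y b) m →ₗ[k] (A.Hom X Y).X c :=
  (A.Hom X Y).cast h ∘ₗ LinearMap.proj (R := k) (0 : Fin 1) ∘ₗ LinearMap.proj (R := k) (0 : Fin 1)

lemma entry_apply (X Y : A.Obj) {a b m c : ℤ} (h : m + b - a = c)
    (f : A.matX (A.single₀ X a) (A.single₀ Y b) m) :
    A.entry X Y h f = (A.Hom X Y).cast h (f 0 0) := rfl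

lemma entry_d (X Y : A.Obj) {a b m m' c c' : ℤ} (h : m + b - a = c) (h' : m' + b - a = c')
    (hm : m + 1 = m') (f : A.matX (A.single₀ X a) (A.single₀ Y b) m) :
    A.entry X Y h' ((A.hull.Hom (A.single X a) (A.single Y b)).d m m' f) =
      b.negOnePow • (A.Hom X Y).d c c' (A.entry X Y h f) := by
  refine (congrArg (A.entry X Y h') (A.single_d X Y a b hm f)).trans ?_
  rw [entry_apply, entry_apply, matD_apply, DGModule.map_units, A.cast_d h h']

lemma entry_comp (X Y Z : A.Obj) {a b c p q n p' q' n' : ℤ} (hp : p + c - b = p')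
    (hq : q + b - a = q') (hn : n + c - a = n') (h : p + q = n) (h' : p' + q' = n')
    (g : A.matX (A.single₀ Y b) (A.single₀ Z c) p) (f : A.matX (A.single₀ X a) (A.single₀ Y b) q) :
    A.entry X Z hn (A.matComp h g f) = A.comp h' (A.entry Y Z hp g) (A.entry X Y hq f) := by
  rw [entry_apply, entry_apply, entry_apply, matComp_apply, Fin.sum_univ_one,
    A.comp_cast _ _ _ _ hn]

/-- The map on cocycles sending a matrix of size one to its entry. -/
def entryZ (X Y : A.Obj) {a b m c : ℤ} (h : m + b - a = c) :
    (A.hull.Hom (A.single X a) (A.single Y b)).cocycles m →ₗ[k] (A.Hom X Y).cocycles c :=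
  LinearMap.codRestrict _
    (A.entry X Y h ∘ₗ ((A.hull.Hom (A.single X a) (A.single Y b)).cocycles m).subtype) fun f => by
    have h₁ := A.entry_d X Y h (show m + 1 + b - a = c + 1 by omega) rfl f.1
    rw [(DGModule.mem_cocycles _ _).1 f.2] at h₁
    rw [DGModule.mem_cocycles]
    exact (smul_eq_zero_iff_eq b.negOnePow).1 (h₁.symm.trans (map_zero _))

/-- The map on cohomology sending a matrix of size one to its entry. -/
def entryH (X Y : A.Obj) {a b m c : ℤ} (h : m + b - a = c) :
    (A.hull.Hom (A.single X a) (A.single Y b)).H m →ₗ[k] (A.Hom X Y).H c :=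
  Submodule.mapQ _ _ (A.entryZ X Y h) (by
    rintro f ⟨y, hy⟩
    have h₁ := A.entry_d X Y (show m - 1 + b - a = c - 1 by omega) h (by omega) y
    refine ⟨b.negOnePow • A.entry X Y (show m - 1 + b - a = c - 1 by omega) y, ?_⟩
    rw [DGModule.map_units, ← h₁, hy]
    rfl)

lemma entryH_mk (X Y : A.Obj) {a b m c : ℤ} (h : m + b - a = c)
    (f : (A.hull.Hom (A.single X a) (A.single Y b)).cocycles m) :
    A.entryH X Y h (DGModule.mkH _ m f) = (A.Hom X Y).mkH c (A.entryZ X Y h f) := rfl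

lemma entryH_comp (X Y Z : A.Obj) {a b c p q n p' q' n' : ℤ} (hp : p + c - b = p')
    (hq : q + b - a = q') (hn : n + c - a = n') (h : p + q = n) (h' : p' + q' = n')
    (g : (A.hull.Hom (A.single Y b) (A.single Z c)).H p)
    (f : (A.hull.Hom (A.single X a) (A.single Y b)).H q) :
    A.entryH X Z hn (A.hull.compH h g f) = A.compH h' (A.entryH Y Z hp g) (A.entryH X Y hq f) := by
  obtain ⟨g, rfl⟩ := Submodule.mkQ_surjective _ g
  obtain ⟨f, rfl⟩ := Submodule.mkQ_surjective _ f
  change (A.Hom X Z).mkH n' (A.entryZ X Z hn (A.hull.compZ h g f)) =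
    (A.Hom X Z).mkH n' (A.compZ h' (A.entryZ Y Z hp g) (A.entryZ X Y hq f))
  refine congrArg ((A.Hom X Z).mkH n') (Subtype.ext ?_)
  exact A.entry_comp X Y Z hp hq hn h h' g.1 f.1

lemma entryH_one (X : A.Obj) {a : ℤ} (h : 0 + a - a = 0) :
    A.entryH X X h (A.hull.oneH (A.single X a)) = A.oneH X := by
  change (A.Hom X X).mkH 0 (A.entryZ X X h (A.hull.oneZ (A.single X a))) =
    (A.Hom X X).mkH 0 (A.oneZ X)
  refine congrArg ((A.Hom X X).mkH 0) (Subtype.ext ?_)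
  change A.entry X X h (A.matOne (A.single₀ X a)) = A.one X
  rw [entry_apply, matOne_self]
  exact DGModule.cast_cast _ _ _ _

lemma entryH_inverse (X Y : A.Obj) {a b p q : ℤ} (hp : 0 + a - b = p) (hq : 0 + b - a = q)
    (h : p + q = 0) (g : (A.hull.Hom (A.single Y b) (A.single X a)).H 0)
    (f : (A.hull.Hom (A.single X a) (A.single Y b)).H 0)
    (hgf : A.hull.compH (add_zero 0) g f = A.hull.oneH (A.single X a)) :
    A.compH h (A.entryH Y X hp g) (A.entryH X Y hq f) = A.oneH X :=
  (A.entryH_comp X Y X hp hq (show 0 + a - a = 0 by omega) (add_zero 0) h g f).symm.trans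
    ((congrArg (A.entryH X X (show 0 + a - a = 0 by omega)) hgf).trans (A.entryH_one X _))

end Graded

section Shift

variable (A : DGCat k) [A.IsPretriangulated]

/-- A chosen object of `A` which is homotopy equivalent to `X[n]`. -/
noncomputable def shObj (X : A.H0) (n : ℤ) : A.H0 :=
  (IsPretriangulated.exists_shift (A := A) X n).choose

/-- The isomorphism between the chosen object and `X[n]` in the homotopy category of the hull. -/
noncomputable def shIso (X : A.H0) (n : ℤ) :
    A.emb.H0map.obj (A.shObj X n) ≅ (A.single X n : A.hull.H0) :=
  (IsPretriangulated.exists_shift (A := A) X n).choose_spec.some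

/-- The canonical class of degree `n` from the shifted object `X⟦n⟧` to `X`. -/
noncomputable def shOut (X : A.H0) (n : ℤ) : (A.Hom (A.shObj X n) X).H n :=
  A.entryH _ _ (show 0 + n - 0 = n by omega) (A.shIso X n).hom

/-- The canonical class of degree `-n` from `X` to the shifted object `X⟦n⟧`. -/
noncomputable def shIn (X : A.H0) (n : ℤ) : (A.Hom X (A.shObj X n)).H (-n) :=
  A.entryH _ _ (show 0 + 0 - n = -n by omega) (A.shIso X n).inv

lemma shIn_shOut (X : A.H0) (n : ℤ) :
    A.compH (neg_add_cancel n) (A.shIn X n) (A.shOut X n) = A.oneH (A.shObj X n) :=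
  A.entryH_inverse (A.shObj X n) X (show 0 + 0 - n = -n by omega) (show 0 + n - 0 = n by omega)
    (neg_add_cancel n) (A.shIso X n).inv (A.shIso X n).hom (A.shIso X n).hom_inv_id

lemma shOut_shIn (X : A.H0) (n : ℤ) :
    A.compH (add_neg_cancel n) (A.shOut X n) (A.shIn X n) = A.oneH X :=
  A.entryH_inverse X (A.shObj X n) (show 0 + n - 0 = n by omega) (show 0 + 0 - n = -n by omega)
    (add_neg_cancel n) (A.shIso X n).hom (A.shIso X n).inv (A.shIso X n).inv_hom_id

/-- The shifted object `X⟦n⟧` is isomorphic to `X` in the graded homotopy category, by an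
isomorphism of degree `n`. -/
noncomputable def grIso (X : A.H0) (n : ℤ) : A.toGr.obj (A.shObj X n) ≅ A.toGr.obj X where
  hom := A.gr n (A.shOut X n)
  inv := A.gr (-n) (A.shIn X n)
  hom_inv_id := (A.gr_compH (neg_add_cancel n) _ _).symm.trans (congrArg (A.gr 0) (A.shIn_shOut X n))
  inv_hom_id := (A.gr_compH (add_neg_cancel n) _ _).symm.trans (congrArg (A.gr 0) (A.shOut_shIn X n))

lemma grIso_eqToHom (X : A.H0) {m n : ℤ} (h : m = n) (h' : A.shObj X m = A.shObj X n) :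
    A.toGr.map (eqToHom h') ≫ (A.grIso X n).hom = (A.grIso X m).hom := by
  subst h
  rw [eqToHom_refl, CategoryTheory.Functor.map_id, Category.id_comp]

variable {A} in
/-- An isomorphism of the graded homotopy category that has degree zero. -/
def isoOfGr {X Y : A.H0} (f : X ⟶ Y) (g : Y ⟶ X) (e : A.toGr.obj X ≅ A.toGr.obj Y)
    (hf : A.toGr.map f = e.hom) (hg : A.toGr.map g = e.inv) : X ≅ Y where
  hom := f
  inv := g
  hom_inv_id := A.toGr.map_injective (by
    rw [Functor.map_comp, hf, hg, e.hom_inv_id, CategoryTheory.Functor.map_id])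
  inv_hom_id := A.toGr.map_injective (by
    rw [Functor.map_comp, hf, hg, e.inv_hom_id, CategoryTheory.Functor.map_id])

/-- The shift of a morphism: the conjugate by the canonical isomorphisms `grIso`. -/
noncomputable def shMap (n : ℤ) {X Y : A.H0} (f : X ⟶ Y) : A.shObj X n ⟶ A.shObj Y n :=
  A.compH (neg_add_cancel n) (A.compH (add_zero (-n)) (A.shIn Y n) f) (A.shOut X n)

lemma toGr_shMap (n : ℤ) {X Y : A.H0} (f : X ⟶ Y) :
    A.toGr.map (A.shMap n f) = (A.grIso X n).hom ≫ A.toGr.map f ≫ (A.grIso Y n).inv :=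
  (A.gr_compH _ _ _).trans (congrArg _ (A.gr_compH _ _ _))

/-- The shift functors on `H⁰(A)`. -/
noncomputable def sh (n : ℤ) : A.H0 ⥤ A.H0 where
  obj X := A.shObj X n
  map f := A.shMap n f
  map_id X := A.toGr.map_injective (by
    simp [toGr_shMap])
  map_comp f g := A.toGr.map_injective (by
    simp [toGr_shMap])

/-- The isomorphism `X⟦0⟧ ≅ X`. -/
noncomputable def shZero (X : A.H0) : A.shObj X 0 ≅ X :=
  isoOfGr (A.shOut X 0) (A.shIn X 0) (A.grIso X 0) rfl rfl

/-- The isomorphism `X⟦m + n⟧ ≅ X⟦m⟧⟦n⟧`. -/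
noncomputable def shAdd (m n : ℤ) (X : A.H0) :
    A.shObj X (m + n) ≅ A.shObj (A.shObj X m) n :=
  isoOfGr
    (A.compH (neg_add_cancel n) (A.shIn (A.shObj X m) n)
      (A.compH (neg_add_cancel_left m n) (A.shIn X m) (A.shOut X (m + n))))
    (A.compH (neg_add_cancel (m + n)) (A.shIn X (m + n))
      (A.compH rfl (A.shOut X m) (A.shOut (A.shObj X m) n)))
    (A.grIso X (m + n) ≪≫ (A.grIso X m).symm ≪≫ (A.grIso (A.shObj X m) n).symm)
    ((A.gr_compH _ _ _).trans ((congrArg (· ≫ _) (A.gr_compH _ _ _)).trans (Category.assoc _ _ _)))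
    ((A.gr_compH _ _ _).trans ((congrArg (· ≫ _) (A.gr_compH _ _ _)).trans (by
      rw [Iso.trans_inv, Iso.trans_inv, Iso.symm_inv, Iso.symm_inv, Category.assoc]
      exact Category.assoc _ _ _)))

lemma toGr_shZero_hom (X : A.H0) : A.toGr.map (A.shZero X).hom = (A.grIso X 0).hom := rfl

lemma toGr_shZero_inv (X : A.H0) : A.toGr.map (A.shZero X).inv = (A.grIso X 0).inv := rfl

lemma toGr_shAdd_hom (m n : ℤ) (X : A.H0) : A.toGr.map (A.shAdd m n X).hom =
    (A.grIso X (m + n)).hom ≫ (A.grIso X m).inv ≫ (A.grIso (A.shObj X m) n).inv :=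
  (A.gr_compH _ _ _).trans ((congrArg (· ≫ _) (A.gr_compH _ _ _)).trans (Category.assoc _ _ _))

lemma shAdd_assoc (l m n : ℤ) (X : A.H0) (h : A.shObj X (l + m + n) = A.shObj X (l + (m + n))) :
    (A.shAdd (l + m) n X).hom ≫ A.shMap n (A.shAdd l m X).hom =
      eqToHom h ≫ (A.shAdd l (m + n) X).hom ≫ (A.shAdd m n (A.shObj X l)).hom := by
  apply A.toGr.map_injective
  simp only [Functor.map_comp, toGr_shAdd_hom, toGr_shMap, Category.assoc,
    Iso.inv_hom_id_assoc]
  rw [← A.grIso_eqToHom X (add_assoc l m n) h, Category.assoc]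

lemma zero_shAdd (n : ℤ) (X : A.H0) (h : A.shObj X (0 + n) = A.shObj X n) :
    (A.shAdd 0 n X).hom = eqToHom h ≫ A.shMap n (A.shZero X).inv := by
  apply A.toGr.map_injective
  simp only [Functor.map_comp, toGr_shAdd_hom, toGr_shMap, toGr_shZero_inv]
  rw [← A.grIso_eqToHom X (zero_add n) h, Category.assoc]

lemma shAdd_zero (n : ℤ) (X : A.H0) (h : A.shObj X (n + 0) = A.shObj X n) :
    (A.shAdd n 0 X).hom = eqToHom h ≫ (A.shZero (A.shObj X n)).inv := by
  apply A.toGr.map_injective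
  simp only [Functor.map_comp, toGr_shAdd_hom, toGr_shZero_inv]
  rw [← A.grIso_eqToHom X (add_zero n) h, Category.assoc, Iso.hom_inv_id_assoc]

/-- The shift on the homotopy category of a pre-triangulated DG category. -/
noncomputable instance : HasShift A.H0 ℤ :=
  hasShiftMk A.H0 ℤ
    { F := A.sh
      zero := NatIso.ofComponents A.shZero fun f => A.toGr.map_injective (by
        simp [sh, toGr_shMap, toGr_shZero_hom])
      add := fun m n => NatIso.ofComponents (A.shAdd m n) fun f => A.toGr.map_injective (by
        simp [sh, toGr_shMap, toGr_shAdd_hom])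
      assoc_hom_app := fun l m n X => A.shAdd_assoc l m n X _
      zero_add_hom_app := fun n X => A.zero_shAdd n X _
      add_zero_hom_app := fun n X => A.shAdd_zero n X _ }

/-- The object `X[n]` in the homotopy category of the hull. -/
def singleH (X : A.H0) (n : ℤ) : A.hull.H0 := A.single X n

/-- The cone of `f` in the homotopy category of the hull. -/
def coneH {X Y : A.H0} (f : (A.Hom X Y).cocycles 0) : A.hull.H0 := A.cone f

/-- The morphism `Y → cone f` in the homotopy category of the hull. -/
def coneInH {X Y : A.H0} (f : (A.Hom X Y).cocycles 0) : A.emb.H0map.obj Y ⟶ A.coneH f :=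
  (A.hull.Hom (A.single Y 0) (A.cone f)).mkH 0 (A.coneIn f)

/-- The morphism `cone f → X[1]` in the homotopy category of the hull. -/
def coneOutH {X Y : A.H0} (f : (A.Hom X Y).cocycles 0) : A.coneH f ⟶ A.singleH X 1 :=
  (A.hull.Hom (A.cone f) (A.single X 1)).mkH 0 (A.coneOut f)

/-- The distinguished triangles of `H⁰(A)`: the triangles `X → Y → Z → X⟦1⟧` which, in the homotopy
category of the hull, are identified with the triangle `X → Y → cone f → X[1]` of a closed
morphism `f` representing `X → Y`. -/
def distTriangles : Set (Pretriangulated.Triangle A.H0) :=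
  {T | ∃ (f : (A.Hom T.obj₁ T.obj₂).cocycles 0) (φ : A.emb.H0map.obj T.obj₃ ≅ A.coneH f),
    T.mor₁ = (A.Hom T.obj₁ T.obj₂).mkH 0 f ∧
    A.emb.H0map.map T.mor₂ ≫ φ.hom = A.coneInH f ∧
    φ.hom ≫ A.coneOutH f = A.emb.H0map.map T.mor₃ ≫ (A.shIso T.obj₁ 1).hom}

end Shift

end DGCat

section Enhancement

variable (k : Type u) [Field k] (T : Type u) [SmallCategory T] [Limits.HasZeroObject T]
  [HasShift T ℤ] [Preadditive T] [Linear k T] [∀ n : ℤ, (shiftFunctor T n).Additive]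
  [Pretriangulated T]

/-- A DG enhancement of the `k`-linear triangulated category `T`: a pre-triangulated DG category
`B` with a `k`-linear equivalence `e : H⁰(B) → T` of triangulated categories. -/
structure DGEnhancement where
  B : DGCat k
  [isPretriangulated : B.IsPretriangulated]
  e : B.H0 ⥤ T
  [isEquivalence : e.IsEquivalence]
  [additive : e.Additive]
  [linear : e.Linear k]
  [commShift : e.CommShift ℤ]
  map_distinguished : ∀ t ∈ B.distTriangles,
    e.mapTriangle.obj t ∈ Pretriangulated.distinguishedTriangles

attribute [instance] DGEnhancement.isPretriangulated DGEnhancement.isEquivalence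
  DGEnhancement.additive DGEnhancement.linear DGEnhancement.commShift

/-- `T` has a strongly unique DG enhancement: for any two DG enhancements there is a quasi-functor
`F` between them such that `H⁰(F)` is an equivalence of triangulated categories compatible, up to
isomorphism of functors, with the equivalences to `T`. -/
def HasStronglyUniqueDGEnhancement : Prop :=
  ∀ E E' : DGEnhancement k T, ∃ (F : DGCat.QuasiFunctor E.B E'.B) (G : E.B.H0 ⥤ E'.B.H0),
    F.IsH0 G ∧ G.IsEquivalence ∧
    (∃ _ : G.CommShift ℤ, ∀ t ∈ E.B.distTriangles, G.mapTriangle.obj t ∈ E'.B.distTriangles) ∧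
    Nonempty (E.e ≅ G ⋙ E'.e)

end Enhancement

/-- A (unital, associative) DG algebra over `k`. -/
structure DGAlg (k : Type u) [Field k] : Type (u + 1) extends DGModule k where
  mul : ∀ {p q n : ℤ}, p + q = n → (X p →ₗ[k] X q →ₗ[k] X n)
  one : X 0
  leibniz : ∀ {p q n p' q' m : ℤ} (h : p + q = n) (hp : p + 1 = p') (hq : q + 1 = q')
    (hm : n + 1 = m) (x : X p) (y : X q),
    d n m (mul h x y) = mul (show p' + q = m by omega) (d p p' x) y +
      p.negOnePow • mul (show p + q' = m by omega) x (d q q' y)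
  assoc : ∀ {p q r a b n : ℤ} (ha : p + q = a) (hb : q + r = b) (h : a + r = n) (h' : p + b = n)
    (x : X p) (y : X q) (z : X r), mul h (mul ha x y) z = mul h' x (mul hb y z)
  one_mul : ∀ {n : ℤ} (x : X n), mul (zero_add n) one x = x
  mul_one : ∀ {n : ℤ} (x : X n), mul (add_zero n) x one = x
  d_one : d 0 1 one = 0

/-- The DG algebra of endomorphisms of an object of a DG category. -/
def DGCat.endAlg {k : Type u} [Field k] (A : DGCat k) (X : A.Obj) : DGAlg k where
  toDGModule := A.Hom X X
  mul h := A.comp h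
  one := A.one X
  leibniz := A.leibniz
  assoc := A.assoc
  one_mul := A.one_comp
  mul_one := A.comp_one
  d_one := A.d_one X

namespace DGAlg

variable {k : Type u} [Field k]

/-- Morphisms of DG algebras. -/
@[ext]
structure Hom (A B : DGAlg k) extends DGModule.Hom A.toDGModule B.toDGModule where
  map_mul : ∀ {p q n : ℤ} (h : p + q = n) (x : A.X p) (y : A.X q),
    f n (A.mul h x y) = B.mul h (f p x) (f q y)
  map_one : f 0 A.one = B.one

/-- A DG algebra, as a DG category with one object. -/
def toDGCat (A : DGAlg k) : DGCat k where
  Obj := PUnit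
  Hom _ _ := A.toDGModule
  comp h := A.mul h
  one _ := A.one
  leibniz := A.leibniz
  assoc := A.assoc
  one_comp := A.one_mul
  comp_one := A.mul_one
  d_one _ := A.d_one

/-- The cohomology algebra, a DG algebra with zero differential. -/
def coh (A : DGAlg k) : DGAlg k := A.toDGCat.coh.endAlg PUnit.unit

/-- Two DG algebras are quasi-isomorphic if they are connected by a zigzag of morphisms of DG
algebras that are quasi-isomorphisms. -/
def QuasiIsomorphic : DGAlg k → DGAlg k → Prop :=
  Relation.EqvGen fun A B => ∃ φ : Hom A B, φ.toHom.IsQuasiIso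

/-- A DG algebra is formal if it is quasi-isomorphic to its cohomology algebra. -/
def IsFormal (A : DGAlg k) : Prop := QuasiIsomorphic A A.coh

end DGAlg

/-- The class `RHom(t, t)` of DG algebras: those quasi-isomorphic to the endomorphism DG algebra of
a lift of `t` to a DG enhancement of `T`. -/
def RHom (k : Type u) [Field k] {T : Type u} [SmallCategory T] [Limits.HasZeroObject T]
    [HasShift T ℤ] [Preadditive T] [Linear k T] [∀ n : ℤ, (shiftFunctor T n).Additive]
    [Pretriangulated T] (t : T) : Set (DGAlg k) :=
  {A | ∃ (E : DGEnhancement k T) (b : E.B.Obj), Nonempty (E.e.obj b ≅ t) ∧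
    DGAlg.QuasiIsomorphic (E.B.endAlg b) A}

/-! ### Quasi-isomorphisms of DG modules in terms of elements. -/

namespace DGModule

variable {k : Type u} [Field k]

/-! An enhancement `(B, e)` of `T₁` becomes the enhancement `(B, Φ ∘ e)` of `T₂`, with the same DG
category. Strong uniqueness for `T₂` compares two such enhancements by a quasi-functor, and the
final `Φ` cancels from the resulting isomorphism because `Φ` is fully faithful; this gives strong
uniqueness for `T₁`. Likewise every algebra `RHom(t, t)` is one of the algebras `RHom(Φ t, Φ t)`
(`RHom.map`), so it remains to compare two algebras attached to one object of `T₂`.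

The core is therefore that a quasi-functor `F` out of a pre-triangulated DG category, with `H⁰(F)`
fully faithful, preserves endomorphism algebras up to quasi-isomorphism
(`QuasiFunctor.endAlg_quasiIsomorphic`). A morphism of the localization `Hqe` is a zigzag of unknown
length. On homotopy categories it can be replaced by a roof `A ← C → B` whose left leg `s` is a
quasi-equivalence (`QuasiFunctor.hasRoof`): the generators of the localization have roofs, and two
roofs compose through a homotopy pullback of DG categories, because the base change of a
quasi-equivalence is a quasi-equivalence (`hoPullbackFst_mem`). No model structure is needed, only
commutation of the pullback square after `H⁰`.

The right leg `t` of the roof is then fully faithful on `H⁰`. Since `C` inherits shifts from `A` in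
its graded homotopy category, cohomology in degree `n` is cohomology in degree `0` with a shifted
target, so `t` is a quasi-isomorphism on all morphism complexes (`HasGradedShifts.isQuasiIso`). Both
legs thus induce quasi-isomorphisms of endomorphism algebras.

The objects match only up to homotopy equivalence. This is settled by homotopy pullbacks again: an
equivalence `f : X → Y` is an object of the homotopy pullback of two identities, and its
endomorphism algebra projects quasi-isomorphically to those of `X` and `Y`
(`endAlg_quasiIsomorphic_of_iso`). Formality is invariant because cohomology carries a zigzag of
quasi-isomorphisms to another one. -/

lemma d_cast_right (M : DGModule k) {m n n' : ℤ} (hn : n = n') (x : M.X m) :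
    M.d m n' x = M.cast hn (M.d m n x) := by
  subst hn; rfl

lemma cast_injective (M : DGModule k) {m n : ℤ} (h : m = n) : Function.Injective (M.cast h) := by
  subst h; exact fun _ _ => id

/-- A criterion for quasi-isomorphisms in terms of elements. -/
lemma Hom.isQuasiIso_of {M N : DGModule k} (φ : Hom M N)
    (hs : ∀ (n : ℤ) (y : N.X n), N.d n (n + 1) y = 0 →
      ∃ x, M.d n (n + 1) x = 0 ∧ ∃ z, N.d (n - 1) n z = φ.f n x - y)
    (hi : ∀ (n : ℤ) (x : M.X n), M.d n (n + 1) x = 0 → ∀ z, N.d (n - 1) n z = φ.f n x →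
      ∃ x', M.d (n - 1) n x' = x) : φ.IsQuasiIso := by
  refine fun n => ⟨(injective_iff_map_eq_zero _).2 fun x hx => ?_, fun y => ?_⟩
  · obtain ⟨x, rfl⟩ := Submodule.mkQ_surjective _ x
    obtain ⟨z, hz⟩ := (N.mkH_eq_zero _).1 hx
    exact (M.mkH_eq_zero _).2 (hi n x.1 x.2 z hz)
  · obtain ⟨y, rfl⟩ := Submodule.mkQ_surjective _ y
    obtain ⟨x, hx, z, hz⟩ := hs n y.1 y.2
    refine ⟨M.mkH n ⟨x, hx⟩, ?_⟩
    rw [← sub_eq_zero, φ.mapH_mk, ← map_sub]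
    exact (N.mkH_eq_zero _).2 ⟨z, hz⟩

/-- Surjectivity on cohomology, read on elements; `Hom.IsQuasiIso.exact` is the same for
injectivity. The two serve to correct cocycles by hand in the homotopy pullback. -/
lemma Hom.IsQuasiIso.exists_lift {M N : DGModule k} {φ : Hom M N} (hφ : φ.IsQuasiIso) {m n : ℤ}
    (h : m + 1 = n) (y : N.X n) (hy : N.d n (n + 1) y = 0) :
    ∃ x, M.d n (n + 1) x = 0 ∧ ∃ z, N.d m n z = φ.f n x - y := by
  obtain rfl : m = n - 1 := by omega
  obtain ⟨x, hx⟩ := (hφ n).2 (N.mkH n ⟨y, hy⟩)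
  obtain ⟨x, rfl⟩ := Submodule.mkQ_surjective _ x
  rw [← sub_eq_zero, φ.mapH_mk, ← map_sub] at hx
  exact ⟨x.1, x.2, (N.mkH_eq_zero _).1 hx⟩

lemma Hom.IsQuasiIso.exact {M N : DGModule k} {φ : Hom M N} (hφ : φ.IsQuasiIso) {m n : ℤ}
    (h : m + 1 = n) (x : M.X n) (hx : M.d n (n + 1) x = 0) (z : N.X m)
    (hz : N.d m n z = φ.f n x) : ∃ x', M.d m n x' = x := by
  obtain rfl : m = n - 1 := by omega
  exact (M.mkH_eq_zero ⟨x, hx⟩).1 ((injective_iff_map_eq_zero _).1 (hφ n).1 _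
    ((N.mkH_eq_zero _).2 ⟨z, hz⟩))

/-- The composition of morphisms of DG modules. -/
def Hom.comp {M N P : DGModule k} (ψ : Hom N P) (φ : Hom M N) : Hom M P where
  f n := ψ.f n ∘ₗ φ.f n
  comm i j x := by simp only [LinearMap.comp_apply]; rw [φ.comm, ψ.comm]

lemma Hom.mapH_comp {M N P : DGModule k} (ψ : Hom N P) (φ : Hom M N) (n : ℤ) :
    ⇑((ψ.comp φ).mapH n) = ψ.mapH n ∘ φ.mapH n := by
  funext x
  obtain ⟨x, rfl⟩ := Submodule.mkQ_surjective _ x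
  rfl

lemma Hom.IsQuasiIso.comp {M N P : DGModule k} {ψ : Hom N P} {φ : Hom M N} (hψ : ψ.IsQuasiIso)
    (hφ : φ.IsQuasiIso) : (ψ.comp φ).IsQuasiIso := fun n => by
  rw [mapH_comp]; exact (hψ n).comp (hφ n)

/-! ### Homotopy pullbacks of complexes. -/

section HoPullback

variable {M N W : DGModule k} (u : Hom M W) (v : Hom N W)

/-- The differential of the homotopy pullback. -/
def hoPullbackD (i j : ℤ) :
    (M.X i × N.X i × W.X (i - 1)) →ₗ[k] (M.X j × N.X j × W.X (j - 1)) :=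
  (M.d i j ∘ₗ LinearMap.fst k _ _).prod ((N.d i j ∘ₗ LinearMap.fst k _ _ ∘ₗ
    LinearMap.snd k _ _).prod (if h : i + 1 = j then
      W.cast (show i = j - 1 by omega) ∘ₗ (u.f i ∘ₗ LinearMap.fst k _ _ -
        v.f i ∘ₗ LinearMap.fst k _ _ ∘ₗ LinearMap.snd k _ _) -
        W.d (i - 1) (j - 1) ∘ₗ LinearMap.snd k _ _ ∘ₗ LinearMap.snd k _ _ else 0))

lemma hoPullbackD_apply {i j : ℤ} (h : i + 1 = j) (x : M.X i × N.X i × W.X (i - 1)) :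
    hoPullbackD u v i j x = (M.d i j x.1, N.d i j x.2.1,
      W.cast (show i = j - 1 by omega) (u.f i x.1 - v.f i x.2.1) -
        W.d (i - 1) (j - 1) x.2.2) := by
  simp only [hoPullbackD, dif_pos h]
  rfl

lemma hoPullbackD_shape (i j : ℤ) (h : i + 1 ≠ j) : hoPullbackD u v i j = 0 := by
  rw [hoPullbackD, dif_neg h, M.shape i j h, N.shape i j h]
  rfl

/-- The homotopy pullback of `u : M → W` and `v : N → W`. -/
def hoPullback : DGModule k where
  X n := M.X n × N.X n × W.X (n - 1)
  d := hoPullbackD u v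
  shape := hoPullbackD_shape u v
  d_d i j l x := by
    by_cases hj : i + 1 = j
    swap
    · rw [hoPullbackD_shape u v i j hj]; exact map_zero _
    by_cases hl : j + 1 = l
    swap
    · rw [hoPullbackD_shape u v j l hl]; rfl
    rw [hoPullbackD_apply u v hj, hoPullbackD_apply u v hl]
    refine Prod.ext (M.d_d _ _ _ _) (Prod.ext (N.d_d _ _ _ _) ?_)
    dsimp only
    -- In the third component, `u (dx) - v (dy)` cancels against `d (u x - v y)`; the rest
    -- reconciles the degrees `i` and `j - 1`.
    rw [map_sub (W.d _ _), W.d_d, sub_zero, u.comm, v.comm, ← map_sub]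
    obtain rfl : i = j - 1 := by omega
    rw [cast_rfl, W.d_cast_right (show j = l - 1 by omega) (m := j - 1), sub_self]
    rfl

lemma hoPullback_closed_iff {n : ℤ} (x : M.X n × N.X n × W.X (n - 1)) :
    (hoPullback u v).d n (n + 1) x = 0 ↔ M.d n (n + 1) x.1 = 0 ∧ N.d n (n + 1) x.2.1 = 0 ∧
      W.d (n - 1) n x.2.2 = u.f n x.1 - v.f n x.2.1 := by
  change hoPullbackD u v n (n + 1) x = 0 ↔ _
  rw [hoPullbackD_apply u v rfl, Prod.ext_iff, Prod.ext_iff,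
    W.d_cast_right (show n = n + 1 - 1 by omega), ← map_sub]
  refine and_congr Iff.rfl (and_congr Iff.rfl ?_)
  change W.cast _ _ = 0 ↔ _
  rw [map_eq_zero_iff _ (W.cast_injective _), sub_eq_zero, eq_comm]

lemma hoPullback_d_eq_iff {n : ℤ} (x : M.X (n - 1) × N.X (n - 1) × W.X (n - 1 - 1))
    (y : M.X n × N.X n × W.X (n - 1)) :
    (hoPullback u v).d (n - 1) n x = y ↔ M.d (n - 1) n x.1 = y.1 ∧ N.d (n - 1) n x.2.1 = y.2.1 ∧
      u.f (n - 1) x.1 - v.f (n - 1) x.2.1 - W.d (n - 1 - 1) (n - 1) x.2.2 = y.2.2 := by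
  change hoPullbackD u v (n - 1) n x = y ↔ _
  rw [hoPullbackD_apply u v (by omega), Prod.ext_iff, Prod.ext_iff, cast_rfl]

/-- The first projection of the homotopy pullback. -/
def hoPullbackFst : Hom (hoPullback u v) M where
  f _ := LinearMap.fst k _ _
  comm _ _ _ := rfl

/-- The second projection of the homotopy pullback. -/
def hoPullbackSnd : Hom (hoPullback u v) N where
  f _ := LinearMap.fst k _ _ ∘ₗ LinearMap.snd k _ _
  comm _ _ _ := rfl

/-- The kernel of the projection is, up to sign and shift, the cone of `v`, hence acyclic. The proof
unwinds this on elements: a closed triple is a pair of cocycles with a primitive of `u x₁ - v x₂`.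
-/
lemma hoPullbackFst_isQuasiIso (hv : v.IsQuasiIso) : (hoPullbackFst u v).IsQuasiIso := by
  refine Hom.isQuasiIso_of _ (fun n y hy => ?_) (fun n ⟨x₁, x₂, x₃⟩ hx z hz => ?_)
  · obtain ⟨x, hx, z, hz⟩ := hv.exists_lift (show n - 1 + 1 = n by omega) (u.f n y)
      (by rw [← u.comm, hy, map_zero])
    refine ⟨(y, x, -z), (hoPullback_closed_iff u v _).2 ⟨hy, hx, ?_⟩, 0, ?_⟩
    · dsimp only
      rw [map_neg, hz, neg_sub]
    · rw [map_zero]; exact (sub_self y).symm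
  · obtain ⟨-, h₂, h₃⟩ := (hoPullback_closed_iff u v ⟨x₁, x₂, x₃⟩).1 hx
    dsimp only at h₃
    change M.d (n - 1) n z = x₁ at hz
    -- Since `d (u z) = u x₁` and `d x₃ = u x₁ - v x₂`, the element `u z - x₃` is a primitive of `v
    -- x₂`.
    obtain ⟨y, hy⟩ := hv.exact (show n - 1 + 1 = n by omega) x₂ h₂ (u.f _ z - x₃) (by
      rw [map_sub, ← u.comm, hz, h₃]; abel)
    -- The pair `(z, y)` bounds the first two components but misses `x₃` by the cocycle `u z - v y -
    -- x₃`. Lifting that cocycle along `v`, up to the boundary of `t`, corrects `y` without changing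
    -- its differential.
    obtain ⟨y', hy', t, ht⟩ := hv.exists_lift (show n - 1 - 1 + 1 = n - 1 by omega)
      (u.f _ z - v.f _ y - x₃) (by
        rw [W.d_cast_right (show n = n - 1 + 1 by omega), map_eq_zero_iff _ (W.cast_injective _),
          map_sub, map_sub, ← u.comm, ← v.comm, hz, hy, h₃, sub_self])
    refine ⟨(z, y + y', -t), (hoPullback_d_eq_iff u v _ _).2 ⟨hz, ?_, ?_⟩⟩
    · dsimp only
      rw [map_add, hy, N.d_cast_right (show n - 1 + 1 = n by omega) y', hy', map_zero, add_zero]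
    · dsimp only
      rw [map_neg, map_add, ht]; abel

lemma hoPullbackSnd_isQuasiIso (hu : u.IsQuasiIso) : (hoPullbackSnd u v).IsQuasiIso := by
  refine Hom.isQuasiIso_of _ (fun n y hy => ?_) (fun n ⟨x₁, x₂, x₃⟩ hx z hz => ?_)
  · obtain ⟨x, hx, z, hz⟩ := hu.exists_lift (show n - 1 + 1 = n by omega) (v.f n y)
      (by rw [← v.comm, hy, map_zero])
    refine ⟨(x, y, z), (hoPullback_closed_iff u v _).2 ⟨hx, hy, hz⟩, 0, ?_⟩
    rw [map_zero]; exact (sub_self y).symm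
  · obtain ⟨h₁, -, h₃⟩ := (hoPullback_closed_iff u v ⟨x₁, x₂, x₃⟩).1 hx
    dsimp only at h₃
    change N.d (n - 1) n z = x₂ at hz
    obtain ⟨y, hy⟩ := hu.exact (show n - 1 + 1 = n by omega) x₁ h₁ (v.f _ z + x₃) (by
      rw [map_add, ← v.comm, hz, h₃]; abel)
    obtain ⟨y', hy', t, ht⟩ := hu.exists_lift (show n - 1 - 1 + 1 = n - 1 by omega)
      (x₃ + v.f _ z - u.f _ y) (by
        rw [W.d_cast_right (show n = n - 1 + 1 by omega), map_eq_zero_iff _ (W.cast_injective _),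
          map_sub, map_add, ← u.comm, ← v.comm, hz, hy, h₃, sub_add_cancel, sub_self])
    refine ⟨(y + y', z, t), (hoPullback_d_eq_iff u v _ _).2 ⟨?_, hz, ?_⟩⟩
    · dsimp only
      rw [map_add, hy, M.d_cast_right (show n - 1 + 1 = n by omega) y', hy', map_zero, add_zero]
    · dsimp only
      rw [map_add, ht]; abel

end HoPullback

end DGModule

/-! ### Composition with homotopy equivalences. -/

namespace DGCat

variable {k : Type u} [Field k]

lemma cast_comp (A : DGCat k) {X Y Z : A.Obj} {p q n n' : ℤ} (hn : n = n') (h : p + q = n)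
    (g : (A.Hom Y Z).X p) (f : (A.Hom X Y).X q) :
    (A.Hom X Z).cast hn (A.comp h g f) = A.comp (h.trans hn) g f := by
  subst hn; rfl

/-- Composition with a closed morphism `g : Y → Z` of degree zero. -/
def postcomp (A : DGCat k) (X : A.Obj) {Y Z : A.Obj} (g : (A.Hom Y Z).cocycles 0) :
    DGModule.Hom (A.Hom X Y) (A.Hom X Z) where
  f n := A.comp (zero_add n) g.1
  comm i j x := by
    by_cases h : i + 1 = j
    · rw [A.leibniz (p' := 1) (zero_add i) (zero_add 1) h h, ((DGModule.mem_cocycles_iff _ _).1 g.2)]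
      simp
    · rw [DGModule.shape _ _ _ h, DGModule.shape _ _ _ h]
      exact map_zero _

/-- Composition with a closed morphism `f : X → Y` of degree zero. -/
def precomp (A : DGCat k) {X Y : A.Obj} (f : (A.Hom X Y).cocycles 0) (Z : A.Obj) :
    DGModule.Hom (A.Hom Y Z) (A.Hom X Z) where
  f n := (A.comp (add_zero n)).flip f.1
  comm i j x := by
    by_cases h : i + 1 = j
    · rw [LinearMap.flip_apply, LinearMap.flip_apply,
        A.leibniz (q' := 1) (add_zero i) h (zero_add 1) h, ((DGModule.mem_cocycles_iff _ _).1 f.2)]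
      simp
    · rw [DGModule.shape _ _ _ h, DGModule.shape _ _ _ h]
      exact map_zero _

/-- The morphism of the homotopy category given by a closed morphism of degree zero. -/
def classH0 (A : DGCat k) {X Y : A.H0} (f : (A.Hom X Y).cocycles 0) : X ⟶ Y :=
  (A.Hom X Y).mkH 0 f

lemma classH0_surjective (A : DGCat k) {X Y : A.H0} (f : X ⟶ Y) : ∃ g, A.classH0 g = f :=
  Submodule.mkQ_surjective _ f

/-- Phrased with `compH`, the inverse in `H⁰` can act on cohomology classes of every degree. -/
lemma exists_inverse (A : DGCat k) {X Y : A.Obj} {f : (A.Hom X Y).cocycles 0}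
    (hf : IsIso (A.classH0 f)) : ∃ g : (A.Hom Y X).H 0,
      A.compH (add_zero 0) g ((A.Hom X Y).mkH 0 f) = A.oneH X ∧
        A.compH (add_zero 0) ((A.Hom X Y).mkH 0 f) g = A.oneH Y :=
  hf.out

lemma postcomp_mapH (A : DGCat k) (X : A.Obj) {Y Z : A.Obj} (g : (A.Hom Y Z).cocycles 0) (n : ℤ)
    (x : (A.Hom X Y).H n) :
    (A.postcomp X g).mapH n x = A.compH (zero_add n) ((A.Hom Y Z).mkH 0 g) x := by
  obtain ⟨x, rfl⟩ := Submodule.mkQ_surjective _ x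
  rfl

lemma precomp_mapH (A : DGCat k) {X Y : A.Obj} (f : (A.Hom X Y).cocycles 0) (Z : A.Obj) (n : ℤ)
    (x : (A.Hom Y Z).H n) :
    (A.precomp f Z).mapH n x = A.compH (add_zero n) x ((A.Hom X Y).mkH 0 f) := by
  obtain ⟨x, rfl⟩ := Submodule.mkQ_surjective _ x
  rfl

lemma postcomp_isQuasiIso (A : DGCat k) (X : A.Obj) {Y Z : A.Obj} (g : (A.Hom Y Z).cocycles 0)
    (hg : IsIso (A.classH0 g)) : (A.postcomp X g).IsQuasiIso := fun n => by
  obtain ⟨g', h₁, h₂⟩ := A.exists_inverse hg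
  refine Function.bijective_iff_has_inverse.2
    ⟨fun x => A.compH (zero_add n) g' x, fun x => ?_, fun x => ?_⟩
  · dsimp only
    rw [postcomp_mapH, ← A.assocH (add_zero 0) (zero_add n) (zero_add n), h₁, A.oneH_comp]
  · dsimp only
    rw [postcomp_mapH, ← A.assocH (add_zero 0) (zero_add n) (zero_add n), h₂, A.oneH_comp]

lemma precomp_isQuasiIso (A : DGCat k) {X Y : A.Obj} (f : (A.Hom X Y).cocycles 0) (Z : A.Obj)
    (hf : IsIso (A.classH0 f)) : (A.precomp f Z).IsQuasiIso := fun n => by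
  obtain ⟨f', h₁, h₂⟩ := A.exists_inverse hf
  refine Function.bijective_iff_has_inverse.2
    ⟨fun x => A.compH (add_zero n) x f', fun x => ?_, fun x => ?_⟩
  · dsimp only
    rw [precomp_mapH, A.assocH (add_zero n) (add_zero 0) (add_zero n) (add_zero n), h₂, A.compH_one]
  · dsimp only
    rw [precomp_mapH, A.assocH (add_zero n) (add_zero 0) (add_zero n) (add_zero n), h₁, A.compH_one]

/-! ### Homotopy pullbacks of DG categories. -/

section HoPullback

variable {A B C : DGCat k} (F : DGFunctor A C) (G : DGFunctor B C)

/-- Objects of the homotopy pullback of `F : A → C` and `G : B → C`: objects of `A` and `B` with a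
homotopy equivalence between their images in `C`. -/
structure HoPullbackObj : Type u where
  fst : A.Obj
  snd : B.Obj
  f : (C.Hom (F.obj fst) (G.obj snd)).cocycles 0
  isIso : IsIso (C.classH0 f)

/-- The DG module of morphisms of the homotopy pullback. -/
def hoPullbackHom (X Y : HoPullbackObj F G) : DGModule k :=
  DGModule.hoPullback ((C.postcomp (F.obj X.fst) Y.f).comp (F.map X.fst Y.fst))
    ((C.precomp X.f (G.obj Y.snd)).comp (G.map X.snd Y.snd))

/-- The elements of the DG modules of morphisms of the homotopy pullback. -/
abbrev HoPullbackX (X Y : HoPullbackObj F G) (n : ℤ) : Type u :=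
  (A.Hom X.fst Y.fst).X n × (B.Hom X.snd Y.snd).X n × (C.Hom (F.obj X.fst) (G.obj Y.snd)).X (n - 1)

/-- The degree equation carried by `C.comp` absorbs the `cast` in the differential, so the sign
computations below are free of casts. -/
lemma hoPullbackHom_d (X Y : HoPullbackObj F G) {i j : ℤ} (h : i + 1 = j)
    (x : HoPullbackX F G X Y i) :
    (hoPullbackHom F G X Y).d i j x = ((A.Hom _ _).d i j x.1, (B.Hom _ _).d i j x.2.1,
      C.comp (show 0 + i = j - 1 by omega) Y.f.1 ((F.map _ _).f i x.1) -
        C.comp (show i + 0 = j - 1 by omega) ((G.map _ _).f i x.2.1) X.f.1 -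
        (C.Hom _ _).d (i - 1) (j - 1) x.2.2) := by
  refine (DGModule.hoPullbackD_apply _ _ h x).trans (Prod.ext rfl (Prod.ext rfl ?_))
  refine congrArg (· - _) ((map_sub _ _ _).trans ?_)
  exact congrArg₂ (· - ·) (C.cast_comp _ _ _ _) (C.cast_comp _ _ _ _)

/-- The composition of the homotopy pullback. -/
def hoPullbackComp {X Y Z : HoPullbackObj F G} {p q n : ℤ} (h : p + q = n) :
    HoPullbackX F G Y Z p →ₗ[k] HoPullbackX F G X Y q →ₗ[k] HoPullbackX F G X Z n :=
  LinearMap.mk₂ k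
    (fun g f => (A.comp h g.1 f.1, B.comp h g.2.1 f.2.1,
      C.comp (show p - 1 + q = n - 1 by omega) g.2.2 ((F.map _ _).f q f.1) +
        p.negOnePow • C.comp (show p + (q - 1) = n - 1 by omega) ((G.map _ _).f p g.2.1) f.2.2))
    (fun _ _ _ => by ext <;> simp; abel)
    (fun c _ _ => by ext <;> simp [smul_comm c])
    (fun _ _ _ => by ext <;> simp; abel)
    (fun c _ _ => by ext <;> simp [smul_comm c])

lemma hoPullbackComp_apply {X Y Z : HoPullbackObj F G} {p q n : ℤ} (h : p + q = n)
    (g : HoPullbackX F G Y Z p) (f : HoPullbackX F G X Y q) :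
    hoPullbackComp F G h g f = (A.comp h g.1 f.1, B.comp h g.2.1 f.2.1,
      C.comp (show p - 1 + q = n - 1 by omega) g.2.2 ((F.map _ _).f q f.1) +
        p.negOnePow • C.comp (show p + (q - 1) = n - 1 by omega) ((G.map _ _).f p g.2.1) f.2.2) :=
  rfl

/-- Only the third component needs work. Differentiating `g` and differentiating `f` each produce
the mixed term `G(g) ∘ Y.f ∘ F(f)`; the sign `(-1)^p` in the composition makes the two cancel. -/
lemma hoPullback_leibniz {X Y Z : HoPullbackObj F G} {p q n p' q' m : ℤ} (h : p + q = n)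
    (hp : p + 1 = p') (hq : q + 1 = q') (hm : n + 1 = m) (g : HoPullbackX F G Y Z p)
    (f : HoPullbackX F G X Y q) :
    (hoPullbackHom F G X Z).d n m (hoPullbackComp F G h g f) =
      (hoPullbackComp F G (show p' + q = m by omega) ((hoPullbackHom F G Y Z).d p p' g) f +
        p.negOnePow • hoPullbackComp F G (show p + q' = m by omega) g
          ((hoPullbackHom F G X Y).d q q' f) : HoPullbackX F G X Z m) := by
  rw [hoPullbackHom_d F G _ _ hm, hoPullbackHom_d F G _ _ hp, hoPullbackHom_d F G _ _ hq,
    hoPullbackComp_apply, hoPullbackComp_apply, hoPullbackComp_apply]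
  refine Prod.ext (A.leibniz h hp hq hm _ _) (Prod.ext (B.leibniz h hp hq hm _ _) ?_)
  dsimp only [Prod.snd_add, Prod.smul_snd, Prod.fst_add, Prod.smul_fst]
  rw [F.map_comp, G.map_comp, map_add, DGModule.map_units,
    C.leibniz (p' := p' - 1) (q' := q') (m := m - 1) (show p - 1 + q = n - 1 by omega) (by omega)
      hq (by omega),
    C.leibniz (p' := p') (q' := q' - 1) (m := m - 1) (show p + (q - 1) = n - 1 by omega) hp
      (by omega) (by omega)]
  simp only [map_sub, LinearMap.sub_apply]
  rw [C.assoc (a := p' - 1) (b := n) (n := m - 1) (by omega) h (by omega) (by omega) Z.f.1,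
    C.assoc (a := p' - 1) (b := q' - 1) (n := m - 1) (by omega) (by omega) (by omega) (by omega)
      _ Y.f.1,
    C.assoc (a := n) (b := q' - 1) (n := m - 1) h (by omega) (by omega) (by omega) _ _ X.f.1,
    (F.map _ _).comm, (G.map _ _).comm]
  subst hp
  simp only [smul_add, smul_sub, smul_smul, Int.negOnePow_succ, Int.negOnePow_sub,
    Int.negOnePow_one, Int.units_mul_self, one_smul, mul_neg, mul_one, Units.neg_smul]
  abel

lemma hoPullback_assoc {W X Y Z : HoPullbackObj F G} {p q r a b n : ℤ} (ha : p + q = a)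
    (hb : q + r = b) (h : a + r = n) (h' : p + b = n) (g : HoPullbackX F G Y Z p)
    (f : HoPullbackX F G X Y q) (e : HoPullbackX F G W X r) :
    hoPullbackComp F G h (hoPullbackComp F G ha g f) e =
      hoPullbackComp F G h' g (hoPullbackComp F G hb f e) := by
  refine Prod.ext (A.assoc _ _ _ _ _ _ _) (Prod.ext (B.assoc _ _ _ _ _ _ _) ?_)
  simp only [hoPullbackComp_apply, map_add, LinearMap.add_apply, F.map_comp, G.map_comp,
    DGModule.map_units, DGModule.units_apply, smul_add, smul_smul]
  rw [C.assoc (a := a - 1) (b := b) (n := n - 1) (by omega) hb (by omega) (by omega),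
    C.assoc (a := a - 1) (b := b - 1) (n := n - 1) (by omega) (by omega) (by omega) (by omega),
    C.assoc (a := a) (b := b - 1) (n := n - 1) ha (by omega) (by omega) (by omega),
    ← Int.negOnePow_add, ha, add_assoc]

/-- The homotopy pullback of `F : A → C` and `G : B → C`. -/
def hoPullback : DGCat k where
  Obj := HoPullbackObj F G
  Hom := hoPullbackHom F G
  comp h := hoPullbackComp F G h
  one X := (A.one X.fst, B.one X.snd, 0)
  leibniz h hp hq hm g f := hoPullback_leibniz F G h hp hq hm g f
  assoc ha hb h h' g f e := hoPullback_assoc F G ha hb h h' g f e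
  one_comp f := by
    refine Prod.ext (A.one_comp _) (Prod.ext (B.one_comp _) ?_)
    change C.comp _ 0 _ + Int.negOnePow 0 • C.comp _ ((G.map _ _).f 0 (B.one _)) _ = _
    rw [map_zero, LinearMap.zero_apply, zero_add, G.map_one, Int.negOnePow_zero, one_smul]
    exact C.one_comp _
  comp_one f := by
    refine Prod.ext (A.comp_one _) (Prod.ext (B.comp_one _) ?_)
    change C.comp _ _ ((F.map _ _).f 0 (A.one _)) + Int.negOnePow _ • C.comp _ _ 0 = _
    rw [map_zero, smul_zero, add_zero, F.map_one]
    exact C.comp_one _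
  d_one X := by
    refine (hoPullbackHom_d F G X X (zero_add 1) _).trans
      (Prod.ext (A.d_one _) (Prod.ext (B.d_one _) ?_))
    dsimp only
    rw [F.map_one, G.map_one, map_zero, sub_zero]
    exact sub_eq_zero.2 ((C.comp_one _).trans (C.one_comp _).symm)

/-- The projection from the homotopy pullback to the first factor. -/
def hoPullbackFst : DGFunctor (hoPullback F G) A where
  obj X := X.fst
  map _ _ := DGModule.hoPullbackFst _ _
  map_comp _ _ _ := rfl
  map_one _ := rfl

/-- The projection from the homotopy pullback to the second factor. -/
def hoPullbackSnd : DGFunctor (hoPullback F G) B where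
  obj X := X.snd
  map _ _ := DGModule.hoPullbackSnd _ _
  map_comp _ _ _ := rfl
  map_one _ := rfl

/-- The map from the second factor is `G` followed by precomposition with `X.f`, which is a
quasi-isomorphism because `X.f` is a homotopy equivalence. -/
lemma hoPullbackFst_isQuasiIso (hG : ∀ X Y, (G.map X Y).IsQuasiIso)
    (X Y : (hoPullback F G).Obj) : ((hoPullbackFst F G).map X Y).IsQuasiIso :=
  DGModule.hoPullbackFst_isQuasiIso _ _ ((C.precomp_isQuasiIso X.f _ X.isIso).comp (hG _ _))

lemma hoPullbackSnd_isQuasiIso (hF : ∀ X Y, (F.map X Y).IsQuasiIso)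
    (X Y : (hoPullback F G).Obj) : ((hoPullbackSnd F G).map X Y).IsQuasiIso :=
  DGModule.hoPullbackSnd_isQuasiIso _ _ ((C.postcomp_isQuasiIso _ Y.f Y.isIso).comp (hF _ _))

/-- The square of homotopy categories of a homotopy pullback commutes up to isomorphism. -/
noncomputable def hoPullbackIso : (hoPullbackFst F G).H0map ⋙ F.H0map ≅
    (hoPullbackSnd F G).H0map ⋙ G.H0map :=
  NatIso.ofComponents
    (fun X => @asIso _ _ _ _ (C.classH0 (HoPullbackObj.f X)) (HoPullbackObj.isIso X))
    (fun {X Y} x => by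
      obtain ⟨x, rfl⟩ := (hoPullback F G).classH0_surjective x
      -- For a closed morphism of degree zero, the third component is a homotopy between the two
      -- sides of the naturality square.
      have h := ((DGModule.hoPullback_closed_iff _ _ _).1 x.2).2.2
      refine sub_eq_zero.1 (((C.Hom _ _).mkH 0).map_sub _ _ |>.symm.trans ?_)
      exact (DGModule.mkH_eq_zero _ _).2 ⟨x.1.2.2, h⟩)

end HoPullback

/-- Bijectivity on cohomology in degree zero already makes `H⁰(F)` fully faithful. -/
lemma quasiEquivalences_of_surjective {A B : DGCat k} (F : DGFunctor A B)
    (hF : ∀ X Y, (F.map X Y).IsQuasiIso) (h : F.H0map.EssSurj) : quasiEquivalences k F :=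
  ⟨hF, { faithful := ⟨fun h => (hF _ _ 0).1 h⟩
         full := ⟨fun f => (hF _ _ 0).2 f⟩
         essSurj := h }⟩

/-- Quasi-equivalences are stable under homotopy base change, which is what allows roofs to be
composed. Essential surjectivity of `H⁰(G)` supplies, for each `X`, some `Y` and a homotopy
equivalence `F X → G Y`, that is, an object over `X`. -/
lemma hoPullbackFst_mem {A B C : DGCat k} (F : DGFunctor A C) (G : DGFunctor B C)
    (hG : quasiEquivalences k G) : quasiEquivalences k (hoPullbackFst F G) := by
  refine quasiEquivalences_of_surjective _ (hoPullbackFst_isQuasiIso F G hG.1) ⟨fun X => ?_⟩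
  have := hG.2
  let e := G.H0map.objObjPreimageIso (F.obj X)
  obtain ⟨f, hf⟩ := C.classH0_surjective e.inv
  exact ⟨(⟨X, G.H0map.objPreimage (F.obj X), f, by
    change IsIso (C.classH0 f); rw [hf]; exact e.symm.isIso_hom⟩ : HoPullbackObj F G), ⟨Iso.refl _⟩⟩

end DGCat

/-! ### Quasi-functors as roofs on homotopy categories. -/

namespace DGCat

variable {k : Type u} [Field k]

lemma isoClass_eq_iff {C D : Type u} [SmallCategory C] [SmallCategory D] (F G : C ⥤ D) :
    isoClass F = isoClass G ↔ Nonempty (F ≅ G) :=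
  Quotient.functor_map_eq_iff isoRel.{u} _ _

lemma isoClass_comp {C D E : Type u} [SmallCategory C] [SmallCategory D] [SmallCategory E]
    (F : C ⥤ D) (G : D ⥤ E) : isoClass (F ⋙ G) = isoClass F ≫ isoClass G :=
  (Quotient.functor isoRel.{u}).map_comp F.toCatHom G.toCatHom

lemma quasiEquivalences_comp {A B C : DGCat k} (F : A ⟶ B) (G : B ⟶ C)
    (hF : quasiEquivalences k F) (hG : quasiEquivalences k G) : quasiEquivalences k (F ≫ G) := by
  refine quasiEquivalences_of_surjective (F ≫ G) (fun X Y => (hG.1 _ _).comp (hF.1 X Y))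
    ⟨fun Z => ?_⟩
  have := hF.2
  have := hG.2
  exact Functor.EssSurj.mem_essImage (F := DGFunctor.H0map F ⋙ DGFunctor.H0map G) Z

lemma quasiEquivalences_id (A : DGCat k) : quasiEquivalences k (𝟙 A) := by
  refine quasiEquivalences_of_surjective (𝟙 A) (fun X Y n => ?_) ⟨fun X => ⟨X, ⟨Iso.refl _⟩⟩⟩
  have : ⇑((DGFunctor.map (𝟙 A) X Y).mapH n) = id := by
    funext x
    obtain ⟨x, rfl⟩ := Submodule.mkQ_surjective _ x
    rfl
  rw [this]
  exact Function.bijective_id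

lemma H0Functor_hoPullback {A B C : DGCat k} (F : A ⟶ C) (G : B ⟶ C) :
    (H0Functor k).map (X := hoPullback F G) (hoPullbackFst F G) ≫ (H0Functor k).map F =
      (H0Functor k).map (X := hoPullback F G) (hoPullbackSnd F G) ≫ (H0Functor k).map G :=
  (isoClass_comp _ _).symm.trans
    (((isoClass_eq_iff _ _).2 ⟨hoPullbackIso F G⟩).trans (isoClass_comp _ _))

/-- The isomorphism class of functors `H⁰(F)` of a quasi-functor `F`. -/
noncomputable def QuasiFunctor.H0 {A B : DGCat k} (F : QuasiFunctor A B) :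
    (H0Functor k).obj A ⟶ (H0Functor k).obj B :=
  (H0Hqe k).map F

lemma QuasiFunctor.H0_comp {A B C : DGCat k} (F : QuasiFunctor A B) (G : QuasiFunctor B C) :
    QuasiFunctor.H0 (F ≫ G) = F.H0 ≫ G.H0 :=
  (H0Hqe k).map_comp F G

lemma QuasiFunctor.H0_Q_map {A B : DGCat k} (F : A ⟶ B) :
    QuasiFunctor.H0 ((quasiEquivalences k).Q.map F) = (H0Functor k).map F :=
  -- The objects on both sides agree by definition, so the `eqToHom`s coming from
  -- `Functor.congr_hom` are identities.
  (Functor.congr_hom (Localization.Construction.fac (H0Functor k) (H0Functor_inverts k)) F).trans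
    ((Category.id_comp _).trans (Category.comp_id _))

/-- The right-hand side is kept as the image of `𝟙 A` because this is the roof of a formal inverse:
left leg `w`, right leg `𝟙 A`. -/
lemma QuasiFunctor.H0_wInv {A B : DGCat k} (w : A ⟶ B) (hw : quasiEquivalences k w) :
    (H0Functor k).map w ≫ QuasiFunctor.H0 (Localization.Construction.wInv w hw) =
      (H0Functor k).map (𝟙 A) := by
  rw [← H0_Q_map, ← H0_Q_map, ← H0_comp, CategoryTheory.Functor.map_id]
  exact congrArg QuasiFunctor.H0 (Localization.Construction.wIso w hw).hom_inv_id

/-- On homotopy categories, the quasi-functor `F` is the composition of the inverse of a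
quasi-equivalence and a DG functor. -/
def QuasiFunctor.HasRoof {A B : DGCat k} (F : QuasiFunctor A B) : Prop :=
  ∃ (C : DGCat k) (s : C ⟶ A) (t : C ⟶ B), quasiEquivalences k s ∧
    (H0Functor k).map s ≫ F.H0 = (H0Functor k).map t

/-- The homotopy pullback of the inner legs `t` and `s'` is the apex of the new roof. Its projection
to `P` is a base change of the quasi-equivalence `s'`, so the new left leg is again a
quasi-equivalence. -/
lemma QuasiFunctor.HasRoof.comp {A B C : DGCat k} {F : QuasiFunctor A B} {G : QuasiFunctor B C}
    (hF : F.HasRoof) (hG : G.HasRoof) : QuasiFunctor.HasRoof (F ≫ G) := by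
  obtain ⟨P, s, t, hs, h⟩ := hF
  obtain ⟨P', s', t', hs', h'⟩ := hG
  let p : hoPullback t s' ⟶ P := hoPullbackFst t s'
  let p' : hoPullback t s' ⟶ P' := hoPullbackSnd t s'
  refine ⟨hoPullback t s', p ≫ s, p' ≫ t',
    quasiEquivalences_comp _ _ (hoPullbackFst_mem t s' hs') hs, ?_⟩
  rw [Functor.map_comp, Functor.map_comp, H0_comp, Category.assoc, reassoc_of% h,
    reassoc_of% (show (H0Functor k).map p ≫ (H0Functor k).map t = _ from H0Functor_hoPullback t s'),
    h']

/-- The morphisms of `Hqe` that have a roof. -/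
def roofs (k : Type u) [Field k] : MorphismProperty (Hqe k) := fun X Y f =>
  QuasiFunctor.HasRoof (A := X.as.obj) (B := Y.as.obj) f

instance : (roofs k).IsStableUnderComposition where
  comp_mem _ _ hf hg := QuasiFunctor.HasRoof.comp hf hg

/-- Morphisms of the localization are generated under composition by images of DG functors and
formal inverses of quasi-equivalences, and both kinds have evident roofs. -/
lemma roofs_eq_top : roofs k = ⊤ := by
  refine Localization.Construction.morphismProperty_eq_top _ (fun X Y f => ?_) (fun X Y w hw => ?_)
  · change QuasiFunctor.HasRoof (A := X) (B := Y) ((quasiEquivalences k).Q.map f)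
    refine ⟨X, 𝟙 X, f, quasiEquivalences_id X, ?_⟩
    rw [QuasiFunctor.H0_Q_map, ← Functor.map_comp, Category.id_comp]
  · exact ⟨X, w, 𝟙 X, hw, QuasiFunctor.H0_wInv w hw⟩

lemma QuasiFunctor.hasRoof {A B : DGCat k} (F : QuasiFunctor A B) : F.HasRoof := by
  have h : roofs k F := by rw [roofs_eq_top]; trivial
  exact h

/-! ### Graded shifts and comparison of endomorphism algebras. -/

/-- Every object of `A` has shifts in the graded homotopy category. -/
def HasGradedShifts (A : DGCat k) : Prop :=
  ∀ (X : A.Obj) (n : ℤ), ∃ (Y : A.Obj) (a : (A.Hom Y X).H n) (b : (A.Hom X Y).H (-n)),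
    A.compH (neg_add_cancel n) b a = A.oneH Y ∧ A.compH (add_neg_cancel n) a b = A.oneH X

lemma hasGradedShifts (A : DGCat k) [A.IsPretriangulated] : A.HasGradedShifts := fun X n =>
  ⟨A.shObj X n, A.shOut X n, A.shIn X n, A.shIn_shOut X n, A.shOut_shIn X n⟩

lemma _root_.DGFunctor.mapH_one {A B : DGCat k} (F : DGFunctor A B) (X : A.Obj) :
    (F.map X X).mapH 0 (A.oneH X) = B.oneH (F.obj X) :=
  congrArg ((B.Hom _ _).mkH 0) (Subtype.ext (F.map_one X))

lemma exists_homotopyEquivalence {A B : DGCat k} (F : DGFunctor A B) [F.H0map.EssSurj]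
    (Y : B.Obj) : ∃ (X : A.Obj) (f : (B.Hom (F.obj X) Y).H 0) (g : (B.Hom Y (F.obj X)).H 0),
      B.compH (add_zero 0) g f = B.oneH (F.obj X) ∧ B.compH (add_zero 0) f g = B.oneH Y := by
  obtain ⟨X, ⟨e⟩⟩ := Functor.EssSurj.mem_essImage (F := F.H0map) Y
  exact ⟨X, e.hom, e.inv, e.hom_inv_id, e.inv_hom_id⟩

/-- The apex of a roof has to inherit shifts. For this condition it is enough to lift graded classes
along `F`, and the pre-triangulated hull does not enter. -/
lemma HasGradedShifts.of_quasiEquivalence {A B : DGCat k} (hB : B.HasGradedShifts) (F : DGFunctor A B)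
    (hF : quasiEquivalences k F) : A.HasGradedShifts := fun X n => by
  obtain ⟨Y, a, b, hba, hab⟩ := hB (F.obj X) n
  have := hF.2
  obtain ⟨Z, f, g, h₁, h₂⟩ := exists_homotopyEquivalence F Y
  -- The shift `Y` of `F X` is replaced by the equivalent object `F Z`: the classes `a ∘ f` and `g ∘
  -- b` are mutually inverse between objects in the image of `F`. Their lifts are mutually inverse
  -- by injectivity on cohomology.
  obtain ⟨a', ha'⟩ := (hF.1 Z X n).2 (B.compH (add_zero n) a f)
  obtain ⟨b', hb'⟩ := (hF.1 X Z (-n)).2 (B.compH (zero_add (-n)) g b)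
  refine ⟨Z, a', b', (hF.1 Z Z 0).1 ?_, (hF.1 X X 0).1 ?_⟩
  · rw [DGFunctor.mapH_compH, ha', hb', F.mapH_one,
      B.assocH (zero_add (-n)) (b := 0) (by omega) _ (add_zero 0),
      ← B.assocH (neg_add_cancel n) (add_zero n) (add_zero 0), hba, B.oneH_comp, h₁]
  · rw [DGFunctor.mapH_compH, ha', hb', F.mapH_one,
      B.assocH (add_zero n) (b := -n) (zero_add (-n)) _ (add_neg_cancel n),
      ← B.assocH (add_zero 0) (zero_add (-n)) (zero_add (-n)), h₂, B.oneH_comp, hab]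

lemma compH_bijective (A : DGCat k) {X Y Z : A.Obj} {m n p q : ℤ} {b : (A.Hom X Y).H p}
    {a : (A.Hom Y X).H q} (hpq : p + q = 0) (hqp : q + p = 0)
    (hba : A.compH hpq b a = A.oneH Y) (hab : A.compH hqp a b = A.oneH X) (h : p + m = n) :
    Function.Bijective (A.compH (X := Z) h b) := by
  refine Function.bijective_iff_has_inverse.2
    ⟨fun x => A.compH (show q + n = m by omega) a x, fun x => ?_, fun x => ?_⟩
  · dsimp only
    rw [← A.assocH hqp h (zero_add m), hab, A.oneH_comp]
  · dsimp only
    rw [← A.assocH hpq _ (zero_add n), hba, A.oneH_comp]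

/-- A DG functor that is fully faithful on homotopy categories is a quasi-isomorphism on
morphisms if its source has shifts. -/
lemma HasGradedShifts.isQuasiIso {A B : DGCat k} (hA : A.HasGradedShifts) (F : DGFunctor A B)
    [F.H0map.Full] [F.H0map.Faithful] (X Y : A.Obj) : (F.map X Y).IsQuasiIso := fun n => by
  obtain ⟨Z, a, b, hba, hab⟩ := hA Y n
  -- Composition with `b` identifies classes `X → Y` of degree `n` with classes `X → Z` of degree
  -- `0`, and composition with the image of `b` does the same in `B`. These identifications commute
  -- with `F`, so degree `n` reduces to degree `0`.
  have h₁ := A.compH_bijective (Z := X) (neg_add_cancel n) (add_neg_cancel n) hba hab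
    (neg_add_cancel n)
  have h₂ := B.compH_bijective (Z := F.obj X) (b := (F.map _ _).mapH _ b) (a := (F.map _ _).mapH _ a)
    (neg_add_cancel n) (add_neg_cancel n)
    (by rw [← F.mapH_compH, hba, F.mapH_one]) (by rw [← F.mapH_compH, hab, F.mapH_one])
    (neg_add_cancel n)
  have h₃ : Function.Bijective ((F.map X Z).mapH 0) :=
    (Functor.FullyFaithful.ofFullyFaithful F.H0map).map_bijective X Z
  refine (Function.Bijective.of_comp_iff' h₂ _).1 ?_
  convert h₃.comp h₁ using 1
  funext f
  exact (F.mapH_compH _ b f).symm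

/-- The morphism of endomorphism algebras induced by a DG functor. -/
def _root_.DGFunctor.endAlgHom {A B : DGCat k} (F : DGFunctor A B) (X : A.Obj) :
    DGAlg.Hom (A.endAlg X) (B.endAlg (F.obj X)) where
  toHom := F.map X X
  map_mul := F.map_comp
  map_one := F.map_one X

lemma _root_.DGFunctor.endAlg_quasiIsomorphic {A B : DGCat k} (F : DGFunctor A B) (X : A.Obj)
    (h : (F.map X X).IsQuasiIso) : DGAlg.QuasiIsomorphic (A.endAlg X) (B.endAlg (F.obj X)) :=
  .rel _ _ ⟨F.endAlgHom X, h⟩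

/-- Homotopy equivalent objects have quasi-isomorphic endomorphism algebras. -/
lemma endAlg_quasiIsomorphic_of_iso (A : DGCat k) {X Y : A.H0} (e : X ≅ Y) :
    DGAlg.QuasiIsomorphic (A.endAlg X) (A.endAlg Y) := by
  obtain ⟨f, hf⟩ := A.classH0_surjective e.hom
  -- As `f` is invertible only up to homotopy, conjugation by it is not a morphism of DG algebras.
  -- The endomorphism algebra of the triple `(X, Y, f)` maps to both algebras instead.
  let Z : (hoPullback (𝟙 A) (𝟙 A)).Obj :=
    ⟨X, Y, f, by change IsIso (A.classH0 f); rw [hf]; exact e.isIso_hom⟩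
  have h := (quasiEquivalences_id A).1
  exact .trans _ _ _
    (.symm _ _ ((hoPullbackFst (𝟙 A) (𝟙 A)).endAlg_quasiIsomorphic Z (hoPullbackFst_isQuasiIso _ _ h Z Z)))
    ((hoPullbackSnd (𝟙 A) (𝟙 A)).endAlg_quasiIsomorphic Z (hoPullbackSnd_isQuasiIso _ _ h Z Z))

/-- If `H⁰` of a quasi-functor from a pre-triangulated DG category is fully faithful, then it
preserves the quasi-isomorphism classes of endomorphism algebras. -/
lemma QuasiFunctor.endAlg_quasiIsomorphic {A B : DGCat k} [A.IsPretriangulated]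
    (F : QuasiFunctor A B) (G : A.H0 ⥤ B.H0) (hF : F.IsH0 G) [G.Full] [G.Faithful] (X : A.H0) :
    DGAlg.QuasiIsomorphic (A.endAlg X) (B.endAlg (G.obj X)) := by
  obtain ⟨C, (s : DGFunctor C A), (t : DGFunctor C B), hs, h⟩ := F.hasRoof
  have : s.H0map.IsEquivalence := hs.2
  obtain ⟨i⟩ : Nonempty (s.H0map ⋙ G ≅ t.H0map) := by
    rw [← isoClass_eq_iff, isoClass_comp]
    exact (congrArg (isoClass s.H0map ≫ ·) hF.symm).trans h
  -- Full faithfulness passes from `H⁰(s)` followed by `G` to `H⁰(t)`.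
  have := Functor.Full.of_iso i
  have := Functor.Faithful.of_iso i
  obtain ⟨Z, ⟨e⟩⟩ := Functor.EssSurj.mem_essImage (F := s.H0map) X
  -- The chain of endomorphism algebras runs through the objects `X`, `s Z`, `Z`, `t Z` and `G X`,
  -- in this order.
  refine .trans _ _ _ (A.endAlg_quasiIsomorphic_of_iso e.symm) (.trans _ _ _ (.symm _ _
    (s.endAlg_quasiIsomorphic Z (hs.1 Z Z))) (.trans _ _ _
    (t.endAlg_quasiIsomorphic Z ?_)
    (B.endAlg_quasiIsomorphic_of_iso ((i.app Z).symm ≪≫ G.mapIso e))))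
  exact (A.hasGradedShifts.of_quasiEquivalence s hs).isQuasiIso t Z Z

end DGCat

/-! ### Invariance of formality under quasi-isomorphism. -/

namespace DGModule

variable {k : Type u} [Field k]

lemma Hom.isQuasiIso_of_bijective {M N : DGModule k} (φ : Hom M N)
    (h : ∀ n, Function.Bijective (φ.f n)) : φ.IsQuasiIso := by
  refine φ.isQuasiIso_of (fun n y hy => ?_) (fun n x hx z hz => ?_)
  · obtain ⟨x, rfl⟩ := (h n).2 y
    rw [← φ.comm] at hy
    exact ⟨x, (h _).1 (hy.trans (map_zero _).symm), 0, by rw [map_zero, sub_self]⟩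
  · obtain ⟨x', rfl⟩ := (h _).2 z
    exact ⟨x', (h n).1 ((φ.comm _ _ _).trans hz)⟩

end DGModule

namespace DGAlg

variable {k : Type u} [Field k]

/-- A DG algebra morphism, as a DG functor between DG categories with one object. -/
def Hom.toDGFunctor {A B : DGAlg k} (φ : Hom A B) : DGFunctor A.toDGCat B.toDGCat where
  obj := id
  map _ _ := φ.toHom
  map_comp := φ.map_mul
  map_one _ := φ.map_one

/-- The morphism of cohomology algebras induced by a morphism of DG algebras. -/
def Hom.coh {A B : DGAlg k} (φ : Hom A B) : Hom A.coh B.coh where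
  f n := φ.toHom.mapH n
  comm _ _ _ := map_zero _
  map_mul h x y := φ.toDGFunctor.mapH_compH h x y
  map_one := φ.toDGFunctor.mapH_one PUnit.unit

/-- Each quasi-isomorphism of the zigzag induces a bijective morphism of cohomology algebras, which
is again a quasi-isomorphism. -/
lemma QuasiIsomorphic.coh {A B : DGAlg k} (h : QuasiIsomorphic A B) :
    QuasiIsomorphic A.coh B.coh := by
  induction h with
  | rel A B h =>
    obtain ⟨φ, hφ⟩ := h
    exact .rel _ _ ⟨φ.coh, DGModule.Hom.isQuasiIso_of_bijective _ hφ⟩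
  | refl A => exact .refl _
  | symm A B _ h => exact .symm _ _ h
  | trans A B C _ _ h h' => exact .trans _ _ _ h h'

lemma QuasiIsomorphic.isFormal_iff {A B : DGAlg k} (h : QuasiIsomorphic A B) :
    A.IsFormal ↔ B.IsFormal :=
  ⟨fun hA => .trans _ _ _ (.symm _ _ h) (.trans _ _ _ hA h.coh),
    fun hB => .trans _ _ _ h (.trans _ _ _ hB (.symm _ _ h.coh))⟩

end DGAlg

/-! ### Transport of enhancements along `Φ`, and the theorem. -/

section Transport

variable {k : Type u} [Field k]
  {T₁ T₂ : Type u} [SmallCategory T₁] [SmallCategory T₂]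
  [Limits.HasZeroObject T₁] [HasShift T₁ ℤ] [Preadditive T₁] [Linear k T₁]
  [∀ n : ℤ, (shiftFunctor T₁ n).Additive] [Pretriangulated T₁]
  [Limits.HasZeroObject T₂] [HasShift T₂ ℤ] [Preadditive T₂] [Linear k T₂]
  [∀ n : ℤ, (shiftFunctor T₂ n).Additive] [Pretriangulated T₂]

/-- The transport of a DG enhancement along an equivalence of triangulated categories. -/
noncomputable def DGEnhancement.map (E : DGEnhancement k T₁) (Φ : T₁ ⥤ T₂) [Φ.IsEquivalence]
    [Φ.CommShift ℤ] [Φ.IsTriangulated] [Φ.Linear k] : DGEnhancement k T₂ where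
  B := E.B
  e := E.e ⋙ Φ
  map_distinguished t ht := Pretriangulated.isomorphic_distinguished _
    (Φ.map_distinguished _ (E.map_distinguished t ht)) _ ((Functor.mapTriangleCompIso E.e Φ).app t)

lemma DGEnhancement.nonempty_of_equivalence (E : DGEnhancement k T₂) (Φ : T₁ ⥤ T₂)
    [Φ.IsEquivalence] [Φ.CommShift ℤ] [Φ.IsTriangulated] [Φ.Linear k] :
    Nonempty (DGEnhancement k T₁) := by
  let e := Φ.asEquivalence
  -- The structures on `Φ` are restated for `e.functor`, which equals `Φ` by definition, so that the
  -- quasi-inverse acquires its shift and triangulated structure from the equivalence `e`.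
  let : e.functor.CommShift ℤ := ‹Φ.CommShift ℤ›
  have : e.functor.IsTriangulated := ‹Φ.IsTriangulated›
  have : e.functor.Linear k := ‹Φ.Linear k›
  let := e.commShiftInverse ℤ
  have := e.commShift_of_functor ℤ
  have : e.IsTriangulated := .mk' e ‹_›
  exact ⟨E.map e.inverse⟩

lemma DGEnhancement.rHom_nonempty (E : DGEnhancement k T₁) (t : T₁) : (RHom k t).Nonempty :=
  ⟨_, E, _, ⟨E.e.objObjPreimageIso t⟩, .refl _⟩

/-- Transport along `Φ` leaves the DG categories unchanged, so the quasi-functor found over `T₂`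
serves over `T₁`; only the isomorphism of functors has to be cancelled along `Φ`. -/
lemma HasStronglyUniqueDGEnhancement.of_equivalence (h : HasStronglyUniqueDGEnhancement k T₂)
    (Φ : T₁ ⥤ T₂) [Φ.IsEquivalence] [Φ.CommShift ℤ] [Φ.IsTriangulated] [Φ.Linear k] :
    HasStronglyUniqueDGEnhancement k T₁ := fun E E' => by
  obtain ⟨F, G, hF, hG, hd, ⟨i⟩⟩ := h (E.map Φ) (E'.map Φ)
  exact ⟨F, G, hF, hG, hd,
    ⟨Functor.fullyFaithfulCancelRight Φ (i ≪≫ (Functor.associator G E'.e Φ).symm)⟩⟩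

lemma HasStronglyUniqueDGEnhancement.quasiIsomorphic (h : HasStronglyUniqueDGEnhancement k T₁)
    {t : T₁} {A A' : DGAlg k} (hA : A ∈ RHom k t) (hA' : A' ∈ RHom k t) :
    DGAlg.QuasiIsomorphic A A' := by
  obtain ⟨E, b, ⟨i⟩, hA⟩ := hA
  obtain ⟨E', b', ⟨i'⟩, hA'⟩ := hA'
  obtain ⟨F, G, hF, hG, -, ⟨j⟩⟩ := h E E'
  let b₀ : E.B.H0 := b
  -- Both `G b` and `b'` are lifts of `t` to the second enhancement, and `E'.e` is fully faithful,
  -- so they are homotopy equivalent.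
  let e : G.obj b₀ ≅ b' := E'.e.preimageIso ((j.app b₀).symm ≪≫ i ≪≫ i'.symm)
  exact .trans _ _ _ (.symm _ _ hA) (.trans _ _ _ (F.endAlg_quasiIsomorphic G hF b₀)
    (.trans _ _ _ (E'.B.endAlg_quasiIsomorphic_of_iso e) hA'))

/-- The lift `b` of `t` is also a lift of `Φ t` to the transported enhancement, with the same
endomorphism algebra. The comparison in the theorem thereby takes place entirely over `T₂`. -/
lemma RHom.map {t : T₁} {A : DGAlg k} (hA : A ∈ RHom k t) (Φ : T₁ ⥤ T₂) [Φ.IsEquivalence]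
    [Φ.CommShift ℤ] [Φ.IsTriangulated] [Φ.Linear k] : A ∈ RHom k (Φ.obj t) := by
  obtain ⟨E, b, ⟨i⟩, hA⟩ := hA
  exact ⟨E.map Φ, b, ⟨Φ.mapIso i⟩, hA⟩

end Transport

theorem mainTheorem5 (k : Type u) [Field k]
    (T₁ T₂ : Type u) [SmallCategory T₁] [SmallCategory T₂]
    [Limits.HasZeroObject T₁] [HasShift T₁ ℤ] [Preadditive T₁] [Linear k T₁]
    [∀ n : ℤ, (shiftFunctor T₁ n).Additive] [Pretriangulated T₁] [IsTriangulated T₁]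
    [Limits.HasZeroObject T₂] [HasShift T₂ ℤ] [Preadditive T₂] [Linear k T₂]
    [∀ n : ℤ, (shiftFunctor T₂ n).Additive] [Pretriangulated T₂] [IsTriangulated T₂]
    (Φ : T₁ ⥤ T₂) [Φ.IsEquivalence] [Φ.CommShift ℤ] [Φ.IsTriangulated] [Φ.Linear k]
    (hT₂ : HasStronglyUniqueDGEnhancement k T₂) :
    HasStronglyUniqueDGEnhancement k T₁ ∧
    ∀ T : T₁,
      (Nonempty (DGEnhancement k T₂) → (RHom k T).Nonempty ∧ (RHom k (Φ.obj T)).Nonempty) ∧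
      ∀ A₁ ∈ RHom k T, ∀ A₂ ∈ RHom k (Φ.obj T),
        DGAlg.QuasiIsomorphic A₁ A₂ ∧ (A₁.IsFormal ↔ A₂.IsFormal) := by
  refine ⟨hT₂.of_equivalence Φ, fun T => ⟨fun ⟨E⟩ => ?_, fun A₁ h₁ A₂ h₂ => ?_⟩⟩
  · obtain ⟨E₁⟩ := E.nonempty_of_equivalence Φ
    exact ⟨E₁.rHom_nonempty T, E.rHom_nonempty (Φ.obj T)⟩
  · have h := hT₂.quasiIsomorphic (RHom.map h₁ Φ) h₂
    exact ⟨h, h.isFormal_iff⟩
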